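/- Let $n\ge 4$ be an even integer, let $(\mathbb S^n,g_0)$ be the unit sphere in $\mathbb R^{n+1}$ with its round metric, let $w\in C^\infty(\mathbb S^n)$ be real-valued, and let $g=e^{2w}g_0$. Let $\Delta_{g_0}=\operatorname{div}_{g_0}\nabla_{g_0}$ be the Laplace–Beltrami operator and let $$P_n=\prod_{k=0}^{\frac n2-1}\bigl(-\Delta_{g_0}+k(n-1-k)\bigr)$$ be the critical GJMS (Paneitz–Beckner) operator of the round sphere. The $n$th-order $Q$-curvature $Q^{(n)}_g$ of $g$ is defined by $$P_n w+(n-1)!=Q^{(n)}_g\,e^{nw}\quad\text{on }\mathbb S^n .$$ If $Q^{(n)}_g\ge 0$ everywhere on $\mathbb S^n$, then the Ricci curvature of $g$ is non-negative, that is, $\mathrm{Ric}_g(v,v)\ge 0$ for every $p\in\mathbb S^n$ and every $v\in T_p\mathbb S^n$. -/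

import Mathlib

open scoped Manifold ContDiff

noncomputable section

namespace ConformalSphere

/-! ### Coordinate formulas on `ℝⁿ` -/

section Coordinates

/-- The `i`-th partial derivative of a function on `ℝⁿ`. -/
def pderiv {n : ℕ} (i : Fin n) (f : EuclideanSpace ℝ (Fin n) → ℝ)
    (y : EuclideanSpace ℝ (Fin n)) : ℝ :=
  fderiv ℝ f y (EuclideanSpace.single i 1)

/-- The Christoffel symbols `Γᵏᵢⱼ = ½ Σₗ gᵏˡ (∂ᵢ gⱼₗ + ∂ⱼ gᵢₗ - ∂ₗ gᵢⱼ)` of a metric on `ℝⁿ` given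
by its matrix of components `G y = (gᵢⱼ(y))`. -/
def christoffel {n : ℕ} (G : EuclideanSpace ℝ (Fin n) → Matrix (Fin n) (Fin n) ℝ)
    (k i j : Fin n) (y : EuclideanSpace ℝ (Fin n)) : ℝ :=
  (1 / 2 : ℝ) * ∑ l, (G y)⁻¹ k l *
    (pderiv i (fun z => G z j l) y + pderiv j (fun z => G z i l) y - pderiv l (fun z => G z i j) y)

/-- The components of the Ricci tensor,
`Rᵢⱼ = Σₖ (∂ₖ Γᵏᵢⱼ - ∂ⱼ Γᵏᵢₖ) + Σₖₗ (Γᵏₖₗ Γˡᵢⱼ - Γᵏⱼₗ Γˡᵢₖ)`. -/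
def ricciCoeff {n : ℕ} (G : EuclideanSpace ℝ (Fin n) → Matrix (Fin n) (Fin n) ℝ)
    (i j : Fin n) (y : EuclideanSpace ℝ (Fin n)) : ℝ :=
  ∑ k, (pderiv k (christoffel G k i j) y - pderiv j (christoffel G k i k) y) +
    ∑ k, ∑ l, (christoffel G k k l y * christoffel G l i j y -
      christoffel G k j l y * christoffel G l i k y)

/-- The Laplace–Beltrami operator in coordinates, as the trace of the Hessian:
`Δ f = Σᵢⱼ gⁱʲ (∂ᵢ∂ⱼ f - Σₖ Γᵏᵢⱼ ∂ₖ f)`. -/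
def laplaceCoord {n : ℕ} (G : EuclideanSpace ℝ (Fin n) → Matrix (Fin n) (Fin n) ℝ)
    (f : EuclideanSpace ℝ (Fin n) → ℝ) (y : EuclideanSpace ℝ (Fin n)) : ℝ :=
  ∑ i, ∑ j, (G y)⁻¹ i j *
    (pderiv i (pderiv j f) y - ∑ k, christoffel G k i j y * pderiv k f y)

end Coordinates

/-! ### Ricci tensor and Laplace–Beltrami operator on an `n`-manifold -/

section Manifold

variable {n : ℕ} {M : Type*} [TopologicalSpace M] [ChartedSpace (EuclideanSpace ℝ (Fin n)) M]

/-- The components `gᵢⱼ` of a field `g` of bilinear forms on the tangent spaces, in the preferred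
chart `φ` at `p`: the value of `g` at `φ⁻¹(y)` on the coordinate vectors `dφ⁻¹(eᵢ)`, `dφ⁻¹(eⱼ)`. -/
def metricCoeff (g : (q : M) → LinearMap.BilinForm ℝ (TangentSpace (𝓡 n) q)) (p : M)
    (y : EuclideanSpace ℝ (Fin n)) : Matrix (Fin n) (Fin n) ℝ :=
  fun i j =>
    g ((extChartAt (𝓡 n) p).symm y)
      (mfderiv 𝓘(ℝ, EuclideanSpace ℝ (Fin n)) (𝓡 n) (extChartAt (𝓡 n) p).symm y
        (EuclideanSpace.single i (1 : ℝ) : EuclideanSpace ℝ (Fin n)))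
      (mfderiv 𝓘(ℝ, EuclideanSpace ℝ (Fin n)) (𝓡 n) (extChartAt (𝓡 n) p).symm y
        (EuclideanSpace.single j (1 : ℝ) : EuclideanSpace ℝ (Fin n)))

/-- The components in `ℝⁿ` of a tangent vector at `p`, in the preferred chart at `p`. -/
def vecCoord (p : M) (v : TangentSpace (𝓡 n) p) : EuclideanSpace ℝ (Fin n) :=
  mfderiv (𝓡 n) 𝓘(ℝ, EuclideanSpace ℝ (Fin n)) (extChartAt (𝓡 n) p) p v

/-- The Ricci tensor `Ric_g(v, w)` of the metric `g` at the point `p`, computed in the preferred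
chart at `p`. -/
def ricci (g : (q : M) → LinearMap.BilinForm ℝ (TangentSpace (𝓡 n) q)) (p : M)
    (v w : TangentSpace (𝓡 n) p) : ℝ :=
  ∑ i, ∑ j, ricciCoeff (metricCoeff g p) i j (extChartAt (𝓡 n) p p) *
    vecCoord p v i * vecCoord p w j

/-- The Laplace–Beltrami operator `Δ_g = div_g grad_g` of the metric `g` (a non-positive operator
on closed manifolds), computed at `p` in the preferred chart at `p`. -/
def laplaceBeltrami (g : (q : M) → LinearMap.BilinForm ℝ (TangentSpace (𝓡 n) q))
    (f : M → ℝ) (p : M) : ℝ :=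
  laplaceCoord (metricCoeff g p) (fun y => f ((extChartAt (𝓡 n) p).symm y))
    (extChartAt (𝓡 n) p p)

/-- The conformal metric `e^{2w} g`. -/
def conformalMetric (w : M → ℝ)
    (g : (q : M) → LinearMap.BilinForm ℝ (TangentSpace (𝓡 n) q)) :
    (q : M) → LinearMap.BilinForm ℝ (TangentSpace (𝓡 n) q) :=
  fun q => Real.exp (2 * w q) • g q

end Manifold

/-! ### The round sphere, its critical GJMS operator and the `Q`-curvature -/

section Sphere

/-- The unit sphere `Sⁿ` in `ℝⁿ⁺¹`. -/
abbrev Sn (n : ℕ) : Type := Metric.sphere (0 : EuclideanSpace ℝ (Fin (n + 1))) 1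

/-- The differential at `p` of the inclusion of `Sⁿ` in `ℝⁿ⁺¹`. -/
def inclDeriv (n : ℕ) (p : Sn n) :
    TangentSpace (𝓡 n) p →L[ℝ] EuclideanSpace ℝ (Fin (n + 1)) :=
  mfderiv (𝓡 n) 𝓘(ℝ, EuclideanSpace ℝ (Fin (n + 1)))
    (fun q : Sn n => (q : EuclideanSpace ℝ (Fin (n + 1)))) p

/-- The round metric `g₀` on `Sⁿ`, induced by the Euclidean inner product of `ℝⁿ⁺¹`. -/
def roundMetric (n : ℕ) (p : Sn n) : LinearMap.BilinForm ℝ (TangentSpace (𝓡 n) p) :=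
  (innerₗ (EuclideanSpace ℝ (Fin (n + 1)))).compl₁₂
    (inclDeriv n p).toLinearMap (inclDeriv n p).toLinearMap

/-- The product `∏_{k < m} (-Δ_{g₀} + k (n - 1 - k))` of operators on functions on `Sⁿ`. -/
def gjmsProd (n : ℕ) : ℕ → (Sn n → ℝ) → Sn n → ℝ
  | 0, f => f
  | k + 1, f => fun p =>
      -laplaceBeltrami (roundMetric n) (gjmsProd n k f) p +
        (k : ℝ) * ((n : ℝ) - 1 - (k : ℝ)) * gjmsProd n k f p

/-- The GJMS operator `P_n = ∏_{k=0}^{n/2-1} (-Δ_{g₀} + k (n - 1 - k))` of order `n` of the round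
sphere `Sⁿ`, for even `n` (the Paneitz–Beckner operator). -/
def gjms (n : ℕ) (f : Sn n → ℝ) : Sn n → ℝ := gjmsProd n (n / 2) f

/-- The `Q`-curvature of order `n` of the metric `g = e^{2w} g₀` on `Sⁿ`, for even `n`; it is
determined by the `Q`-curvature equation `P_n w + (n-1)! = Q_g e^{nw}`, where `(n-1)!` is the
`Q`-curvature of `g₀`. -/
def qCurvature (n : ℕ) (w : Sn n → ℝ) (p : Sn n) : ℝ :=
  Real.exp (-((n : ℝ) * w p)) * (gjms n w p + ((n - 1).factorial : ℝ))

end Sphere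

end ConformalSphere

end

/-! Write `n = 2m + 2`. At `p`, in a `g₀`-unit direction `v`, the conformal change formula gives
`Ric_g(v, v) = (n-1) - (n-2) ∇²w(v, v) - Δw - (n-2) |ξ|²`, where `ξ` is the part of `∇w` orthogonal
to `v`. The term `-|ξ|²` is quadratic in `w`, but since `dw(ξ) = |ξ|²` it equals `|ξ|² - 2 dw(ξ)`,
which for fixed `ξ` is affine in `w`.

The affine expression is then represented by an integral against `f = P_n w + (n-1)!`, which is
non-negative because `Q` is. Up to normalization, `log (1 - ⟪p, x⟫)` is a Green's function of `P_n`.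
Rotations and the Laplacian commute with `P_n`, so integrating by parts turns the first derivatives,
the Hessian and the Laplacian of `w` at `p` into integrals of `f` against derivatives of this
kernel. Constants are integrals against `f` too, because `P_n w` has mean zero. In the resulting
total kernel the terms assemble into a square, so it is non-negative pointwise
(`kernel_pointwise_nonneg`); hence `hessian_inequality`.

The singular kernel is replaced by `log (l - ⟪p, x⟫)` with `l > 1`, and `l` tends to `1`. The factor
of `P_n` with index `k` sends `(l - ⟪p, x⟫)⁻ᵏ` to a combination of the next two powers
(`sLap_invKernel`). The last factor leaves only a multiple of `(l² - 1) (l - ⟪p, x⟫)⁻ᵐ⁻²`, which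
concentrates at `p` (`tendsto_concentrate`); this yields `tendsto_logKernel_gjmsPoly`.

Functions on the sphere are handled as functions on the ambient space constant along rays: the
spherical Laplacian is `‖x‖²` times the Euclidean one, and integration over the sphere is replaced
by integration over the ambient space against a radial bump. Stereographic charts centred at `p`
link this calculus to the coordinate definitions of the Ricci tensor and of the Laplace–Beltrami
operator (`laplaceBeltrami_roundMetric`, `sum_ricciCoeff_conformalMetric`). -/

noncomputable section

namespace ConformalSphere

open MeasureTheory Filter Topology Module
open scoped RealInnerProductSpace

set_option linter.unusedSectionVars false

/-! ### Directional derivatives and the Laplacian -/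

section DirDeriv

variable {E : Type*} [NormedAddCommGroup E] [InnerProductSpace ℝ E]

/-- The derivative of `F` in the constant direction `a`. -/
def dirDeriv (a : E) (F : E → ℝ) (x : E) : ℝ := fderiv ℝ F x a

lemma two_le_infty : (2 : ℕ∞ω) ≤ ∞ := by
  exact WithTop.coe_le_coe.2 (le_top : (2 : ℕ∞) ≤ ⊤)

lemma isOpen_ne_zero : IsOpen ({0}ᶜ : Set E) := isOpen_compl_singleton

lemma ContDiffOn.contDiffAt_ne_zero {F : E → ℝ} {k : ℕ∞ω} (hF : ContDiffOn ℝ k F {0}ᶜ) {x : E}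
    (hx : x ≠ 0) : ContDiffAt ℝ k F x :=
  hF.contDiffAt (isOpen_ne_zero.mem_nhds hx)

lemma contDiffOn_dirDeriv {F : E → ℝ} {s : Set E} (hs : IsOpen s) (hF : ContDiffOn ℝ ∞ F s)
    (a : E) : ContDiffOn ℝ ∞ (dirDeriv a F) s :=
  (hF.fderiv_of_isOpen (m := ∞) hs (by simp)).clm_apply contDiffOn_const

lemma contDiffAt_dirDeriv {F : E → ℝ} {x : E} (hF : ContDiffAt ℝ ∞ F x) (a : E) :
    ContDiffAt ℝ ∞ (dirDeriv a F) x :=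
  (hF.fderiv_right (m := ∞) (by simp)).clm_apply contDiffAt_const

lemma dirDeriv_congr {F G : E → ℝ} {x : E} (h : F =ᶠ[𝓝 x] G) (a : E) :
    dirDeriv a F =ᶠ[𝓝 x] dirDeriv a G := by
  filter_upwards [h.fderiv (𝕜 := ℝ)] with y hy
  simp [dirDeriv, hy]

lemma dirDeriv_add {F G : E → ℝ} {x : E} (hF : DifferentiableAt ℝ F x)
    (hG : DifferentiableAt ℝ G x) (a : E) :
    dirDeriv a (fun y => F y + G y) x = dirDeriv a F x + dirDeriv a G x := by
  simp [dirDeriv, fderiv_fun_add hF hG]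

lemma dirDeriv_sub {F G : E → ℝ} {x : E} (hF : DifferentiableAt ℝ F x)
    (hG : DifferentiableAt ℝ G x) (a : E) :
    dirDeriv a (fun y => F y - G y) x = dirDeriv a F x - dirDeriv a G x := by
  simp [dirDeriv, fderiv_fun_sub hF hG]

lemma dirDeriv_mul {F G : E → ℝ} {x : E} (hF : DifferentiableAt ℝ F x)
    (hG : DifferentiableAt ℝ G x) (a : E) :
    dirDeriv a (fun y => F y * G y) x = dirDeriv a F x * G x + F x * dirDeriv a G x := by
  simp [dirDeriv, fderiv_fun_mul hF hG]
  ring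

lemma dirDeriv_const_mul {F : E → ℝ} {x : E} (c : ℝ) (a : E) :
    dirDeriv a (fun y => c * F y) x = c * dirDeriv a F x := by
  have : (fun y => c * F y) = c • F := rfl
  simp [dirDeriv, this, fderiv_const_smul_field]

lemma dirDeriv_inner (v a x : E) : dirDeriv a (fun y => ⟪v, y⟫) x = ⟪v, a⟫ := by
  have : HasFDerivAt (fun y => ⟪v, y⟫) (innerSL ℝ v) x := (innerSL ℝ v).hasFDerivAt
  simp [dirDeriv, this.fderiv]

lemma dirDeriv_comp {φ : ℝ → ℝ} {F : E → ℝ} {x : E} (hφ : DifferentiableAt ℝ φ (F x))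
    (hF : DifferentiableAt ℝ F x) (a : E) :
    dirDeriv a (fun y => φ (F y)) x = deriv φ (F x) * dirDeriv a F x := by
  have := (hφ.hasDerivAt.comp_hasFDerivAt x hF.hasFDerivAt).fderiv
  simp only [dirDeriv]
  rw [show (fun y => φ (F y)) = φ ∘ F from rfl, this]
  simp

lemma dirDeriv_comp_norm_sq {φ : ℝ → ℝ} (hφ : Differentiable ℝ φ) (a x : E) :
    dirDeriv a (fun y => φ (‖y‖ ^ 2)) x = deriv φ (‖x‖ ^ 2) * (2 * ⟪x, a⟫) := by
  rw [dirDeriv_comp (F := fun y => ‖y‖ ^ 2) hφ.differentiableAt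
    ((contDiff_norm_sq ℝ (n := 1)).differentiable one_ne_zero).differentiableAt]
  simp [dirDeriv, fderiv_norm_sq_apply]

lemma dirDeriv_dirDeriv {F : E → ℝ} {x : E} (hF : ContDiffAt ℝ 2 F x) (a b : E) :
    dirDeriv a (dirDeriv b F) x = fderiv ℝ (fderiv ℝ F) x a b := by
  have h : DifferentiableAt ℝ (fderiv ℝ F) x :=
    (hF.fderiv_right (m := 1) (by norm_num)).differentiableAt one_ne_zero
  have : HasFDerivAt (dirDeriv b F) _ x := h.hasFDerivAt.clm_apply (hasFDerivAt_const b x)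
  rw [dirDeriv, this.fderiv]
  simp

lemma dirDeriv_comm {F : E → ℝ} {x : E} (hF : ContDiffAt ℝ 2 F x) (a b : E) :
    dirDeriv a (dirDeriv b F) x = dirDeriv b (dirDeriv a F) x := by
  rw [dirDeriv_dirDeriv hF, dirDeriv_dirDeriv hF]
  exact (hF.isSymmSndFDerivAt (by simp)).eq a b

lemma dirDeriv_homogeneous {F : E → ℝ} {r c : ℝ} (hr : 0 < r) (hF : ∀ x, F (r • x) = c * F x)
    (a x : E) : dirDeriv a F (r • x) = r⁻¹ * c * dirDeriv a F x := by
  have h1 : fderiv ℝ (fun y => F (r • y)) x = r • fderiv ℝ F (r • x) := fderiv_comp_smul r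
  have h2 : dirDeriv a (fun y => F (r • y)) x = c * dirDeriv a F x := by
    rw [show (fun y => F (r • y)) = fun y => c * F y from funext hF, dirDeriv_const_mul]
  have h3 : r * dirDeriv a F (r • x) = c * dirDeriv a F x := by
    rw [← h2, dirDeriv, dirDeriv, h1]; simp
  field_simp
  linarith

variable [FiniteDimensional ℝ E]

/-- The Euclidean Laplacian. -/
def lap (F : E → ℝ) (x : E) : ℝ :=
  ∑ i, dirDeriv (stdOrthonormalBasis ℝ E i) (dirDeriv (stdOrthonormalBasis ℝ E i) F) x

lemma sum_dirDeriv_mul_inner {ι : Type*} [Fintype ι] (b : OrthonormalBasis ι ℝ E) (F : E → ℝ)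
    (x v : E) : ∑ i, dirDeriv (b i) F x * ⟪v, b i⟫ = dirDeriv v F x := by
  conv_rhs => rw [dirDeriv, ← b.sum_repr' v]
  simp only [map_sum, map_smul, smul_eq_mul, dirDeriv]
  refine Finset.sum_congr rfl fun i _ => ?_
  rw [real_inner_comm, mul_comm]

/-- The Laplacian is a trace, so the basis fixed in `lap` is immaterial. This permits a basis
adapted to a point of the sphere. -/
lemma lap_eq_sum {ι : Type*} [Fintype ι] (b : OrthonormalBasis ι ℝ E) {F : E → ℝ} {x : E}
    (hF : ContDiffAt ℝ 2 F x) : lap F x = ∑ i, dirDeriv (b i) (dirDeriv (b i) F) x := by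
  have h : ∀ {κ : Type _} [Fintype κ] (c : OrthonormalBasis κ ℝ E),
      ∑ i, dirDeriv (c i) (dirDeriv (c i) F) x = Laplacian.laplacian F x := by
    intro κ _ c
    rw [InnerProductSpace.laplacian_eq_iteratedFDeriv_orthonormalBasis F c]
    refine Finset.sum_congr rfl fun i _ => ?_
    rw [dirDeriv_dirDeriv hF, iteratedFDeriv_two_apply]
    simp
  rw [lap, h]
  rw [InnerProductSpace.laplacian_eq_iteratedFDeriv_orthonormalBasis F b]
  refine Finset.sum_congr rfl fun i _ => ?_
  rw [dirDeriv_dirDeriv hF, iteratedFDeriv_two_apply]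
  simp

lemma lap_congr {F G : E → ℝ} {x : E} (h : F =ᶠ[𝓝 x] G) : lap F x = lap G x :=
  Finset.sum_congr rfl fun _ _ => (dirDeriv_congr (dirDeriv_congr h _) _).self_of_nhds

lemma contDiffOn_lap {F : E → ℝ} {s : Set E} (hs : IsOpen s) (hF : ContDiffOn ℝ ∞ F s) :
    ContDiffOn ℝ ∞ (lap F) s :=
  ContDiffOn.sum fun _ _ => contDiffOn_dirDeriv hs (contDiffOn_dirDeriv hs hF _) _

lemma ContDiffAt.eventually_differentiableAt {F : E → ℝ} {x : E} (hF : ContDiffAt ℝ ∞ F x) :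
    ∀ᶠ y in 𝓝 x, DifferentiableAt ℝ F y := by
  filter_upwards [(hF.of_le (m := 1) (by simp)).eventually (by simp)] with y hy
  exact hy.differentiableAt one_ne_zero

lemma lap_add {F G : E → ℝ} {x : E} (hF : ContDiffAt ℝ ∞ F x) (hG : ContDiffAt ℝ ∞ G x) :
    lap (fun y => F y + G y) x = lap F x + lap G x := by
  simp only [lap, ← Finset.sum_add_distrib]
  refine Finset.sum_congr rfl fun i _ => ?_
  rw [← dirDeriv_add ((contDiffAt_dirDeriv hF _).differentiableAt (by simp))
    ((contDiffAt_dirDeriv hG _).differentiableAt (by simp))]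
  refine (dirDeriv_congr ?_ _).self_of_nhds
  filter_upwards [ContDiffAt.eventually_differentiableAt hF,
    ContDiffAt.eventually_differentiableAt hG] with y h1 h2
  exact dirDeriv_add h1 h2 _

lemma lap_const_mul {F : E → ℝ} {x : E} (c : ℝ) :
    lap (fun y => c * F y) x = c * lap F x := by
  simp only [lap, Finset.mul_sum]
  refine Finset.sum_congr rfl fun i _ => ?_
  rw [← dirDeriv_const_mul]
  congr 1
  exact funext fun y => dirDeriv_const_mul c _

lemma lap_mul {F G : E → ℝ} {x : E} (hF : ContDiffAt ℝ ∞ F x) (hG : ContDiffAt ℝ ∞ G x) :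
    lap (fun y => F y * G y) x = lap F x * G x + F x * lap G x +
      2 * ∑ i, dirDeriv (stdOrthonormalBasis ℝ E i) F x *
        dirDeriv (stdOrthonormalBasis ℝ E i) G x := by
  simp only [lap, Finset.mul_sum, Finset.sum_mul, ← Finset.sum_add_distrib]
  refine Finset.sum_congr rfl fun i _ => ?_
  set a := stdOrthonormalBasis ℝ E i
  have hF' := (contDiffAt_dirDeriv hF a).differentiableAt (by simp)
  have hG' := (contDiffAt_dirDeriv hG a).differentiableAt (by simp)
  have hF0 := hF.differentiableAt (by simp)
  have hG0 := hG.differentiableAt (by simp)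
  have h : dirDeriv a (fun y => F y * G y) =ᶠ[𝓝 x]
      fun y => dirDeriv a F y * G y + F y * dirDeriv a G y := by
    filter_upwards [ContDiffAt.eventually_differentiableAt hF,
      ContDiffAt.eventually_differentiableAt hG] with y h1 h2
    exact dirDeriv_mul h1 h2 _
  rw [(dirDeriv_congr h a).self_of_nhds,
    dirDeriv_add (F := fun y => dirDeriv a F y * G y) (G := fun y => F y * dirDeriv a G y)
      (hF'.mul hG0) (hF0.mul hG'),
    dirDeriv_mul hF' hG0, dirDeriv_mul hF0 hG']
  ring

lemma lap_inner (v x : E) : lap (fun y => ⟪v, y⟫) x = 0 := by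
  refine Finset.sum_eq_zero fun i _ => ?_
  have : dirDeriv (stdOrthonormalBasis ℝ E i) (fun y => ⟪v, y⟫) =
      fun _ => ⟪v, stdOrthonormalBasis ℝ E i⟫ := funext fun y => dirDeriv_inner v _ y
  rw [this]
  simp [dirDeriv]

lemma lap_inner_mul {G : E → ℝ} {x : E} (hG : ContDiffAt ℝ ∞ G x) (v : E) :
    lap (fun y => ⟪v, y⟫ * G y) x = ⟪v, x⟫ * lap G x + 2 * dirDeriv v G x := by
  have hv : ContDiffAt ℝ ∞ (fun y => ⟪v, y⟫) x := (innerSL ℝ v).contDiff.contDiffAt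
  rw [lap_mul hv hG, lap_inner, ← sum_dirDeriv_mul_inner (stdOrthonormalBasis ℝ E) G x v]
  simp only [dirDeriv_inner]
  simp [mul_comm]

lemma lap_dirDeriv {F : E → ℝ} {x : E} (hF : ContDiffAt ℝ ∞ F x) (a : E) :
    lap (dirDeriv a F) x = dirDeriv a (lap F) x := by
  have hc : ∀ b, DifferentiableAt ℝ (dirDeriv b (dirDeriv b F)) x := fun b =>
    (contDiffAt_dirDeriv (contDiffAt_dirDeriv hF _) _).differentiableAt (by simp)
  have hev : ∀ᶠ y in 𝓝 x, ContDiffAt ℝ 2 F y :=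
    (hF.of_le (m := 2) (by exact two_le_infty)).eventually (by simp)
  have h : dirDeriv a (lap F) x = ∑ i, dirDeriv a
      (dirDeriv (stdOrthonormalBasis ℝ E i) (dirDeriv (stdOrthonormalBasis ℝ E i) F)) x := by
    have : lap F = fun y => ∑ i, dirDeriv (stdOrthonormalBasis ℝ E i)
      (dirDeriv (stdOrthonormalBasis ℝ E i) F) y := rfl
    rw [this, dirDeriv, fderiv_fun_sum (fun i _ => hc _)]
    simp [dirDeriv]
  rw [h]
  refine Finset.sum_congr rfl fun i _ => ?_
  set b := stdOrthonormalBasis ℝ E i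
  have h1 : dirDeriv b (dirDeriv a F) =ᶠ[𝓝 x] dirDeriv a (dirDeriv b F) := by
    filter_upwards [hev] with y hy using dirDeriv_comm hy _ _
  rw [(dirDeriv_congr h1 b).self_of_nhds]
  exact dirDeriv_comm ((contDiffAt_dirDeriv hF b).of_le (by exact two_le_infty)) _ _

lemma lap_homogeneous {F : E → ℝ} {r c : ℝ} (hr : 0 < r) (hF : ∀ x, F (r • x) = c * F x)
    (x : E) : lap F (r • x) = r⁻¹ * (r⁻¹ * c) * lap F x := by
  simp only [lap, Finset.mul_sum]
  refine Finset.sum_congr rfl fun i _ => ?_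
  exact dirDeriv_homogeneous hr (fun x => dirDeriv_homogeneous hr hF _ x) _ _

end DirDeriv

/-! ### Functions on the sphere, extended to be constant along rays -/

section SphereFun

variable {E : Type*} [NormedAddCommGroup E] [InnerProductSpace ℝ E]

variable (E) in
/-- The functions on `E` that are smooth away from the origin and constant along open rays from the
origin (and vanish at the origin). They correspond to smooth functions on the unit sphere. -/
def sphereFunSubmodule : Submodule ℝ (E → ℝ) where
  carrier := {F | ContDiffOn ℝ ∞ F {0}ᶜ ∧ (∀ r : ℝ, 0 < r → ∀ x, F (r • x) = F x) ∧ F 0 = 0}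
  add_mem' := fun {F G} hF hG => ⟨hF.1.add hG.1, fun r hr x => by
    simp [hF.2.1 r hr x, hG.2.1 r hr x], by simp [hF.2.2, hG.2.2]⟩
  zero_mem' := ⟨contDiffOn_const, by simp, rfl⟩
  smul_mem' := fun c F hF => ⟨contDiffOn_const.mul hF.1, fun r hr x => by
    simp [hF.2.1 r hr x], by simp [hF.2.2]⟩

variable (E) in
/-- The type of smooth functions on the unit sphere of `E`, extended to be constant along rays. -/
def SphereFun : Type _ := sphereFunSubmodule E

instance : AddCommGroup (SphereFun E) := inferInstanceAs (AddCommGroup (sphereFunSubmodule E))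

instance : Module ℝ (SphereFun E) := inferInstanceAs (Module ℝ (sphereFunSubmodule E))

instance : CoeFun (SphereFun E) (fun _ => E → ℝ) := ⟨fun F => F.1⟩

namespace SphereFun

lemma contDiffOn (F : SphereFun E) : ContDiffOn ℝ ∞ F {0}ᶜ := F.2.1

lemma contDiffAt (F : SphereFun E) {x : E} (hx : x ≠ 0) : ContDiffAt ℝ ∞ F x :=
  ContDiffOn.contDiffAt_ne_zero F.contDiffOn hx

lemma differentiableAt (F : SphereFun E) {x : E} (hx : x ≠ 0) : DifferentiableAt ℝ F x :=
  (F.contDiffAt hx).differentiableAt (by simp)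

lemma smul_apply_pos (F : SphereFun E) {r : ℝ} (hr : 0 < r) (x : E) : F (r • x) = F x :=
  F.2.2.1 r hr x

@[simp] lemma apply_zero (F : SphereFun E) : F 0 = 0 := F.2.2.2

@[simp] lemma coe_add (F G : SphereFun E) (x : E) : (F + G) x = F x + G x := rfl
@[simp] lemma coe_sub (F G : SphereFun E) (x : E) : (F - G) x = F x - G x := rfl
@[simp] lemma coe_neg (F : SphereFun E) (x : E) : (-F) x = -F x := rfl
@[simp] lemma coe_smul (c : ℝ) (F : SphereFun E) (x : E) : (c • F) x = c * F x := rfl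
@[simp] lemma coe_zero (x : E) : (0 : SphereFun E) x = 0 := rfl

-- The value at the origin is prescribed, so it never has to be compared.
@[ext] lemma ext {F G : SphereFun E} (h : ∀ x, x ≠ 0 → F x = G x) : F = G := by
  refine Subtype.ext (funext fun x => ?_)
  rcases eq_or_ne x 0 with rfl | hx
  · simp
  · exact h x hx

instance : Mul (SphereFun E) :=
  ⟨fun F G => ⟨fun x => F x * G x, F.contDiffOn.mul G.contDiffOn, fun r hr x => by
    simp [F.smul_apply_pos hr, G.smul_apply_pos hr], by simp⟩⟩

@[simp] lemma coe_mul (F G : SphereFun E) (x : E) : (F * G) x = F x * G x := rfl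

open Classical in
/-- The constant function. -/
def const (c : ℝ) : SphereFun E :=
  ⟨fun x => if x = 0 then 0 else c, by
    refine (contDiffOn_const (c := c)).congr fun x hx => if_neg hx, fun r hr x => by
      simp [hr.ne'], by simp⟩

lemma const_apply (c : ℝ) {x : E} (hx : x ≠ 0) : const c x = c := if_neg hx

/-- Euler's identity. -/
lemma dirDeriv_self (F : SphereFun E) {x : E} (hx : x ≠ 0) : dirDeriv x F x = 0 := by
  have h1 : HasDerivAt (fun r : ℝ => F (r • x)) (fderiv ℝ F ((1 : ℝ) • x) ((1 : ℝ) • x)) 1 := by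
    have h2 : HasFDerivAt F (fderiv ℝ F ((1 : ℝ) • x)) ((1 : ℝ) • x) := by
      rw [one_smul]; exact (F.differentiableAt hx).hasFDerivAt
    exact h2.comp_hasDerivAt (1 : ℝ) ((hasDerivAt_id (1 : ℝ)).smul_const x)
  have h3 : (fun r : ℝ => F (r • x)) =ᶠ[𝓝 1] fun _ => F x := by
    filter_upwards [lt_mem_nhds (zero_lt_one (α := ℝ))] with r hr using F.smul_apply_pos hr x
  have := h1.unique ((hasDerivAt_const (1 : ℝ) (F x)).congr_of_eventuallyEq h3)
  simpa [dirDeriv] using this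

/-- The infinitesimal rotation in the plane of `p` and `v`. -/
def rot (p v : E) : SphereFun E →ₗ[ℝ] SphereFun E where
  toFun F := ⟨fun x => ⟪v, x⟫ * dirDeriv p F x - ⟪p, x⟫ * dirDeriv v F x, by
    have h : ∀ a : E, ContDiffOn ℝ ∞ (fun x => ⟪a, x⟫) {0}ᶜ := fun a =>
      (innerSL ℝ a).contDiff.contDiffOn
    exact ((h v).mul (contDiffOn_dirDeriv isOpen_ne_zero F.contDiffOn p)).sub
      ((h p).mul (contDiffOn_dirDeriv isOpen_ne_zero F.contDiffOn v)), fun r hr x => by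
    have h : ∀ a, dirDeriv a F (r • x) = r⁻¹ * 1 * dirDeriv a F x := fun a =>
      dirDeriv_homogeneous hr (fun x => by rw [F.smul_apply_pos hr, one_mul]) a x
    simp only [h, inner_smul_right]
    field_simp, by simp⟩
  map_add' F G := by
    ext x hx
    have h : ∀ a, dirDeriv a (F + G : SphereFun E) x = dirDeriv a F x + dirDeriv a G x :=
      fun a => dirDeriv_add (F.differentiableAt hx) (G.differentiableAt hx) a
    change ⟪v, x⟫ * dirDeriv p (F + G : SphereFun E) x -
      ⟪p, x⟫ * dirDeriv v (F + G : SphereFun E) x = (⟪v, x⟫ * dirDeriv p F x -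
      ⟪p, x⟫ * dirDeriv v F x) + (⟪v, x⟫ * dirDeriv p G x - ⟪p, x⟫ * dirDeriv v G x)
    simp only [h]
    ring
  map_smul' c F := by
    ext x hx
    have h : ∀ a, dirDeriv a (c • F : SphereFun E) x = c * dirDeriv a F x :=
      fun a => dirDeriv_const_mul c a
    change ⟪v, x⟫ * dirDeriv p (c • F : SphereFun E) x -
      ⟪p, x⟫ * dirDeriv v (c • F : SphereFun E) x =
      c * (⟪v, x⟫ * dirDeriv p F x - ⟪p, x⟫ * dirDeriv v F x)
    simp only [h]
    ring

lemma rot_apply (p v : E) (F : SphereFun E) (x : E) :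
    rot p v F x = ⟪v, x⟫ * dirDeriv p F x - ⟪p, x⟫ * dirDeriv v F x := rfl

lemma rot_mul (p v : E) (F G : SphereFun E) : rot p v (F * G) = rot p v F * G + F * rot p v G := by
  ext x hx
  have h : ∀ a, dirDeriv a (F * G : SphereFun E) x = dirDeriv a F x * G x + F x * dirDeriv a G x :=
    fun a => dirDeriv_mul (F.differentiableAt hx) (G.differentiableAt hx) a
  simp only [rot_apply, coe_add, coe_mul, h]
  ring

variable [FiniteDimensional ℝ E]

/-- The spherical Laplacian. -/
def sLap : SphereFun E →ₗ[ℝ] SphereFun E where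
  toFun F := ⟨fun x => ‖x‖ ^ 2 * lap F x,
    (contDiff_norm_sq ℝ).contDiffOn.mul (contDiffOn_lap isOpen_ne_zero F.contDiffOn),
    fun r hr x => by
      have h : lap F (r • x) = r⁻¹ * (r⁻¹ * 1) * lap F x :=
        lap_homogeneous hr (fun x => by rw [F.smul_apply_pos hr, one_mul]) x
      simp only [h, norm_smul, mul_pow, Real.norm_eq_abs, sq_abs]
      field_simp, by simp⟩
  map_add' F G := by
    ext x hx
    have h : lap (F + G : SphereFun E) x = lap F x + lap G x :=
      lap_add (F.contDiffAt hx) (G.contDiffAt hx)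
    change ‖x‖ ^ 2 * lap (F + G : SphereFun E) x = ‖x‖ ^ 2 * lap F x + ‖x‖ ^ 2 * lap G x
    rw [h]
    ring
  map_smul' c F := by
    ext x hx
    have h : lap (c • F : SphereFun E) x = c * lap F x := lap_const_mul c
    change ‖x‖ ^ 2 * lap (c • F : SphereFun E) x = c * (‖x‖ ^ 2 * lap F x)
    rw [h]
    ring

lemma sLap_apply (F : SphereFun E) (x : E) : sLap F x = ‖x‖ ^ 2 * lap F x := rfl

lemma sLap_const (c : ℝ) : sLap (const c : SphereFun E) = 0 := by
  ext x hx
  have h : (const c : SphereFun E) =ᶠ[𝓝 x] fun _ => c := by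
    filter_upwards [isOpen_ne_zero.mem_nhds hx] with y hy using const_apply c hy
  have h0 : ∀ (a : E) (c : ℝ), dirDeriv a (fun _ : E => c) = fun _ => 0 := fun a c => by
    ext y; simp [dirDeriv]
  have h1 : lap (fun _ : E => c) x = 0 := by
    simp only [lap, h0, Finset.sum_const_zero]
  rw [sLap_apply, lap_congr h, h1, mul_zero]
  rfl

/-- Rotations are isometries fixing `‖x‖`. Concretely, the cross terms `2 ∂ᵥ∂ₚF` and `2 ∂ₚ∂ᵥF`
created by the linear coefficients cancel by symmetry of second derivatives. -/
lemma rot_sLap (p v : E) (F : SphereFun E) : rot p v (sLap F) = sLap (rot p v F) := by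
  ext x hx
  have hF := F.contDiffAt hx
  have hl : ContDiffAt ℝ ∞ (lap F) x :=
    ContDiffOn.contDiffAt_ne_zero (contDiffOn_lap isOpen_ne_zero F.contDiffOn) hx
  have hn : DifferentiableAt ℝ (fun y : E => ‖y‖ ^ 2) x :=
    (contDiff_norm_sq ℝ (n := 1)).contDiffAt.differentiableAt one_ne_zero
  have h : ∀ a, dirDeriv a (sLap F) x = 2 * ⟪x, a⟫ * lap F x + ‖x‖ ^ 2 * dirDeriv a (lap F) x := by
    intro a
    have := dirDeriv_mul hn (hl.differentiableAt (by simp)) a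
    rw [show dirDeriv a (sLap F) x = dirDeriv a (fun y => ‖y‖ ^ 2 * lap F y) x from rfl, this]
    congr 2
    simp [dirDeriv, fderiv_norm_sq_apply]
  have hin : ∀ a b : E, ContDiffAt ℝ ∞ (fun y => ⟪a, y⟫ * dirDeriv b F y) x := fun a b =>
    ((innerSL ℝ a).contDiff.contDiffAt).mul (contDiffAt_dirDeriv hF b)
  have h2 : lap (rot p v F) x = ⟪v, x⟫ * dirDeriv p (lap F) x - ⟪p, x⟫ * dirDeriv v (lap F) x := by
    have e : (rot p v F : E → ℝ) = fun y => ⟪v, y⟫ * dirDeriv p F y +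
        (-1) * (⟪p, y⟫ * dirDeriv v F y) := by
      ext y; rw [rot_apply]; ring
    rw [e, lap_add (hin v p) (contDiffAt_const.mul (hin p v)), lap_const_mul,
      lap_inner_mul (contDiffAt_dirDeriv hF p), lap_inner_mul (contDiffAt_dirDeriv hF v),
      lap_dirDeriv hF, lap_dirDeriv hF,
      dirDeriv_comm (hF.of_le (by exact two_le_infty)) v p]
    ring
  rw [rot_apply, sLap_apply, h, h, h2, real_inner_comm x p, real_inner_comm x v]
  ring

end SphereFun

end SphereFun

/-! ### Averages over the sphere -/

section Avg

variable {E : Type*} [NormedAddCommGroup E] [InnerProductSpace ℝ E] [FiniteDimensional ℝ E]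
  [MeasurableSpace E] [BorelSpace E]

/-- A bump function supported in `[1, 3]`. -/
def annulusBump : ContDiffBump (2 : ℝ) := ⟨1 / 2, 1, by norm_num, by norm_num⟩

lemma annulusBump_eq_zero {s : ℝ} (hs : s ∉ Set.Icc (1 : ℝ) 3) : annulusBump s = 0 := by
  refine annulusBump.zero_of_le_dist ?_
  rw [Set.mem_Icc, not_and_or, not_le, not_le] at hs
  rw [Real.dist_eq, le_abs]
  change 1 ≤ _ ∨ 1 ≤ _
  rcases hs with h | h
  · right; linarith
  · left; linarith

lemma annulusBump_contDiff : ContDiff ℝ ∞ annulusBump := annulusBump.contDiff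

lemma mul_radial_eventuallyEq_zero {β : ℝ → ℝ} (hs : ∀ s, s ∉ Set.Icc (1 : ℝ) 3 → β s = 0)
    (F : E → ℝ) : (fun x => F x * β (‖x‖ ^ 2)) =ᶠ[𝓝 0] fun _ => 0 := by
  filter_upwards [Metric.ball_mem_nhds (0 : E) one_pos] with x hx
  have hx' : ‖x‖ < 1 := by simpa using hx
  rw [hs _ fun h => by nlinarith [h.1, norm_nonneg x], mul_zero]

lemma contDiff_mul_radial {F : E → ℝ} (hF : ContDiffOn ℝ ∞ F {0}ᶜ) {β : ℝ → ℝ}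
    (hβ : ContDiff ℝ ∞ β) (hs : ∀ s, s ∉ Set.Icc (1 : ℝ) 3 → β s = 0) :
    ContDiff ℝ ∞ fun x => F x * β (‖x‖ ^ 2) := by
  rw [contDiff_iff_contDiffAt]
  intro x
  rcases eq_or_ne x 0 with rfl | hx
  · exact contDiffAt_const.congr_of_eventuallyEq (mul_radial_eventuallyEq_zero hs F)
  · exact (ContDiffOn.contDiffAt_ne_zero hF hx).mul
      (hβ.contDiffAt.comp x (contDiff_norm_sq ℝ).contDiffAt)

lemma hasCompactSupport_mul_radial (F : E → ℝ) {β : ℝ → ℝ}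
    (hs : ∀ s, s ∉ Set.Icc (1 : ℝ) 3 → β s = 0) :
    HasCompactSupport fun x => F x * β (‖x‖ ^ 2) := by
  refine HasCompactSupport.of_support_subset_isCompact (isCompact_closedBall (0 : E) 2) ?_
  intro x hx
  rw [mem_closedBall_zero_iff]
  by_contra h
  push Not at h
  exact hx (show F x * β (‖x‖ ^ 2) = 0 by rw [hs _ fun h' => by nlinarith [h'.2], mul_zero])

lemma integrable_dirDeriv {G : E → ℝ} (hG : ContDiff ℝ ∞ G) (hc : HasCompactSupport G) (a : E) :
    Integrable (dirDeriv a G) :=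
  ((hG.continuous_fderiv (by simp)).clm_apply
    continuous_const).integrable_of_hasCompactSupport (hc.fderiv_apply (𝕜 := ℝ) a)

lemma integral_dirDeriv {G : E → ℝ} (hG : ContDiff ℝ ∞ G) (hc : HasCompactSupport G) (a : E) :
    ∫ x, dirDeriv a G x = 0 := by
  have h := integral_mul_fderiv_eq_neg_fderiv_mul_of_integrable (μ := (volume : Measure E))
    (f := fun _ => (1 : ℝ)) (g := G) (v := a) (by simp)
    (by simpa [dirDeriv] using! integrable_dirDeriv hG hc a)
    (by simpa using hG.continuous.integrable_of_hasCompactSupport hc) (by simp)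
    (fun x _ => (hG.differentiable (by simp)).differentiableAt)
  simpa [dirDeriv] using h

namespace SphereFun

lemma integrable (F : SphereFun E) : Integrable fun x => F x * annulusBump (‖x‖ ^ 2) :=
  (contDiff_mul_radial F.contDiffOn annulusBump_contDiff
    fun _ => annulusBump_eq_zero).continuous.integrable_of_hasCompactSupport
    (hasCompactSupport_mul_radial F fun _ => annulusBump_eq_zero)

/-- A positive multiple of the integral over the unit sphere. -/
def avg : SphereFun E →ₗ[ℝ] ℝ where
  toFun F := ∫ x, F x * annulusBump (‖x‖ ^ 2)
  map_add' F G := by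
    rw [← integral_add F.integrable G.integrable]
    simp [add_mul]
  map_smul' c F := by
    simp only [coe_smul, mul_assoc, RingHom.id_apply, smul_eq_mul, integral_const_mul]

lemma avg_apply (F : SphereFun E) : avg F = ∫ x, F x * annulusBump (‖x‖ ^ 2) := rfl

lemma avg_mono {F G : SphereFun E} (h : ∀ x, ‖x‖ = 1 → F x ≤ G x) : avg F ≤ avg G := by
  refine integral_mono F.integrable G.integrable fun x => ?_
  rcases eq_or_ne x 0 with rfl | hx
  · simp
  · have hx' := norm_pos_iff.2 hx
    have := h (‖x‖⁻¹ • x) (by rw [norm_smul, norm_inv, norm_norm, inv_mul_cancel₀ hx'.ne'])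
    rw [F.smul_apply_pos (inv_pos.2 hx'), G.smul_apply_pos (inv_pos.2 hx')] at this
    exact mul_le_mul_of_nonneg_right this (annulusBump.nonneg)

lemma avg_const_pos [Nontrivial E] : 0 < avg (const 1 : SphereFun E) := by
  obtain ⟨u, hu⟩ := exists_norm_eq E (Real.sqrt_nonneg 2)
  rw [avg_apply]
  refine Continuous.integral_pos_of_hasCompactSupport_nonneg_nonzero (x := u)
    (contDiff_mul_radial (const 1 : SphereFun E).contDiffOn annulusBump_contDiff
      fun _ => annulusBump_eq_zero).continuous
    (hasCompactSupport_mul_radial _ fun _ => annulusBump_eq_zero) ?_ ?_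
  · intro x
    rcases eq_or_ne x 0 with rfl | hx
    · simp
    · simp [const_apply 1 hx, annulusBump.nonneg]
  · have hu0 : u ≠ 0 := by
      rintro rfl
      rw [norm_zero] at hu
      exact (Real.sqrt_pos.2 (zero_lt_two (α := ℝ))).ne hu
    rw [const_apply 1 hu0, hu, Real.sq_sqrt (by norm_num), one_mul]
    refine (annulusBump.pos_of_mem_ball ?_).ne'
    simpa using annulusBump.rOut_pos

/-- The difference is the integral of the divergence of the compactly supported field `β(‖x‖²) (H ∇F
- F ∇H)`. The derivative of the radial weight pairs only with radial derivatives of `F` and `H`,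
which vanish by Euler's identity. -/
lemma avg_sLap_mul (F H : SphereFun E) : avg (sLap F * H) = avg (F * sLap H) := by
  set b := stdOrthonormalBasis ℝ E
  -- The extra factor `s` absorbs the `‖x‖²` in `sLap`.
  set β : ℝ → ℝ := fun s => s * annulusBump s with hβdef
  have hβ : ContDiff ℝ ∞ β := contDiff_id.mul annulusBump_contDiff
  have hs : ∀ s, s ∉ Set.Icc (1 : ℝ) 3 → β s = 0 := fun s hs => by
    simp [hβdef, annulusBump_eq_zero hs]
  set A : Fin (finrank ℝ E) → E → ℝ := fun i x => dirDeriv (b i) F x * H x - F x * dirDeriv (b i) H x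
  have hA : ∀ i, ContDiffOn ℝ ∞ (A i) {0}ᶜ := fun i =>
    ((contDiffOn_dirDeriv isOpen_ne_zero F.contDiffOn _).mul H.contDiffOn).sub
      (F.contDiffOn.mul (contDiffOn_dirDeriv isOpen_ne_zero H.contDiffOn _))
  have hV : ∀ i, ContDiff ℝ ∞ fun x => A i x * β (‖x‖ ^ 2) := fun i =>
    contDiff_mul_radial (hA i) hβ hs
  have hVc : ∀ i, HasCompactSupport fun x => A i x * β (‖x‖ ^ 2) := fun i =>
    hasCompactSupport_mul_radial _ hs
  have h0 : ∫ x, ∑ i, dirDeriv (b i) (fun x => A i x * β (‖x‖ ^ 2)) x = 0 := by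
    rw [integral_finsetSum _ fun i _ => integrable_dirDeriv (hV i) (hVc i) _]
    exact Finset.sum_eq_zero fun i _ => integral_dirDeriv (hV i) (hVc i) _
  rw [← sub_eq_zero, ← map_sub, avg_apply, ← h0]
  congr 1
  ext x
  rcases eq_or_ne x 0 with rfl | hx
  · rw [apply_zero, zero_mul]
    refine (Finset.sum_eq_zero fun i _ => ?_).symm
    rw [(dirDeriv_congr (mul_radial_eventuallyEq_zero hs (A i)) _).self_of_nhds]
    simp [dirDeriv]
  have hF := F.differentiableAt hx
  have hH := H.differentiableAt hx
  have hF' : ∀ i, DifferentiableAt ℝ (dirDeriv (b i) F) x := fun i =>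
    (contDiffAt_dirDeriv (F.contDiffAt hx) _).differentiableAt (by simp)
  have hH' : ∀ i, DifferentiableAt ℝ (dirDeriv (b i) H) x := fun i =>
    (contDiffAt_dirDeriv (H.contDiffAt hx) _).differentiableAt (by simp)
  have hβ' : DifferentiableAt ℝ (fun x : E => β (‖x‖ ^ 2)) x :=
    (hβ.comp (contDiff_norm_sq ℝ)).contDiffAt.differentiableAt (by simp)
  have hA' : ∀ i, DifferentiableAt ℝ (A i) x := fun i =>
    ((hF' i).mul hH).sub (hF.mul (hH' i))
  have key : ∀ i, dirDeriv (b i) (fun x => A i x * β (‖x‖ ^ 2)) x =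
      (dirDeriv (b i) (dirDeriv (b i) F) x * H x - F x * dirDeriv (b i) (dirDeriv (b i) H) x) *
        β (‖x‖ ^ 2) + (dirDeriv (b i) F x * ⟪x, b i⟫ * H x - F x * (dirDeriv (b i) H x * ⟪x, b i⟫)) *
        (2 * deriv β (‖x‖ ^ 2)) := by
    intro i
    rw [dirDeriv_mul (hA' i) hβ', dirDeriv_comp_norm_sq (hβ.differentiable (by simp)),
      dirDeriv_sub (F := fun x => dirDeriv (b i) F x * H x)
        (G := fun x => F x * dirDeriv (b i) H x) ((hF' i).mul hH) (hF.mul (hH' i)),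
      dirDeriv_mul (hF' i) hH, dirDeriv_mul hF (hH' i)]
    simp only [A]
    ring
  simp only [key, Finset.sum_add_distrib, ← Finset.sum_mul, Finset.sum_sub_distrib,
    ← Finset.mul_sum, sum_dirDeriv_mul_inner, dirDeriv_self _ hx]
  simp only [coe_sub, coe_mul, sLap_apply, lap, β]
  ring

/-- A rotation field is divergence free and tangent to spheres, so it annihilates the radial bump
and the integrand is a divergence. -/
lemma avg_rot {p v : E} (F : SphereFun E) : avg (rot p v F) = 0 := by
  have hin : ∀ a : E, ContDiffOn ℝ ∞ (fun x => ⟪a, x⟫) {0}ᶜ := fun a =>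
    (innerSL ℝ a).contDiff.contDiffOn
  have hV : ∀ a : E, ContDiff ℝ ∞ fun x => (⟪a, x⟫ * F x) * annulusBump (‖x‖ ^ 2) := fun a =>
    contDiff_mul_radial ((hin a).mul F.contDiffOn) annulusBump_contDiff fun _ => annulusBump_eq_zero
  have hVc : ∀ a : E, HasCompactSupport fun x => (⟪a, x⟫ * F x) * annulusBump (‖x‖ ^ 2) := fun a =>
    hasCompactSupport_mul_radial _ fun _ => annulusBump_eq_zero
  have h0 : ∫ x, (dirDeriv p (fun x => (⟪v, x⟫ * F x) * annulusBump (‖x‖ ^ 2)) x -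
      dirDeriv v (fun x => (⟪p, x⟫ * F x) * annulusBump (‖x‖ ^ 2)) x) = 0 := by
    rw [integral_sub (integrable_dirDeriv (hV v) (hVc v) p) (integrable_dirDeriv (hV p) (hVc p) v),
      integral_dirDeriv (hV v) (hVc v), integral_dirDeriv (hV p) (hVc p), sub_zero]
  rw [avg_apply, ← h0]
  congr 1
  ext x
  rcases eq_or_ne x 0 with rfl | hx
  · have := fun c a : E => (dirDeriv_congr (mul_radial_eventuallyEq_zero (β := annulusBump)
      (fun _ => annulusBump_eq_zero) (fun x => ⟪c, x⟫ * F x)) a).self_of_nhds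
    rw [this, this]
    simp [dirDeriv]
  have hF := F.differentiableAt hx
  have hi : ∀ a : E, DifferentiableAt ℝ (fun x => ⟪a, x⟫) x := fun a =>
    (innerSL ℝ a).differentiableAt
  have hb : DifferentiableAt ℝ (fun x : E => annulusBump (‖x‖ ^ 2)) x :=
    (annulusBump_contDiff.comp (contDiff_norm_sq ℝ)).contDiffAt.differentiableAt (by simp)
  have key : ∀ c a : E, dirDeriv a (fun x => (⟪c, x⟫ * F x) * annulusBump (‖x‖ ^ 2)) x =
      (⟪c, a⟫ * F x + ⟪c, x⟫ * dirDeriv a F x) * annulusBump (‖x‖ ^ 2) +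
        ⟪c, x⟫ * F x * (deriv annulusBump (‖x‖ ^ 2) * (2 * ⟪x, a⟫)) := by
    intro c a
    rw [dirDeriv_mul (F := fun x => ⟪c, x⟫ * F x) ((hi c).mul hF) hb, dirDeriv_mul (hi c) hF,
      dirDeriv_inner, dirDeriv_comp_norm_sq (annulusBump_contDiff.differentiable (by simp))]
  rw [key, key, rot_apply, real_inner_comm v x, real_inner_comm p x, real_inner_comm v p]
  ring

lemma avg_rot_mul {p v : E} (F H : SphereFun E) : avg (rot p v F * H) = -avg (F * rot p v H) := by
  rw [eq_neg_iff_add_eq_zero, ← map_add, ← rot_mul, avg_rot]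

end SphereFun

end Avg

/-! ### Linear functions, zonal functions and logarithmic kernels on the sphere -/

section Zonal

variable {E : Type*} [NormedAddCommGroup E] [InnerProductSpace ℝ E]

lemma dirDeriv_inv_norm {x : E} (hx : x ≠ 0) (a : E) :
    dirDeriv a (fun y => ‖y‖⁻¹) x = -⟪x, a⟫ * ‖x‖⁻¹ ^ 3 := by
  have hn := norm_ne_zero_iff.2 hx
  have h1 : HasFDerivAt (fun y : E => ‖y‖ ^ 2) (2 • innerSL ℝ x) x := by
    simpa using (hasStrictFDerivAt_norm_sq x).hasFDerivAt
  have h2 : HasDerivAt (fun s : ℝ => (Real.sqrt s)⁻¹)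
      (-(1 / (2 * Real.sqrt (‖x‖ ^ 2))) / Real.sqrt (‖x‖ ^ 2) ^ 2) (‖x‖ ^ 2) := by
    exact (Real.hasDerivAt_sqrt (by positivity)).inv (by positivity)
  have h3 := h2.comp_hasFDerivAt x h1
  have h4 : ((fun s : ℝ => (Real.sqrt s)⁻¹) ∘ fun y : E => ‖y‖ ^ 2) = fun y => ‖y‖⁻¹ := by
    ext y; simp
  rw [h4] at h3
  rw [dirDeriv, h3.fderiv]
  simp only [norm_nonneg, Real.sqrt_sq, smul_apply,
    smul_eq_mul, nsmul_eq_mul, innerSL_apply_apply, Nat.cast_ofNat]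
  field_simp

lemma contDiffAt_inv_norm {x : E} (hx : x ≠ 0) {k : ℕ∞ω} : ContDiffAt ℝ k (fun y => ‖y‖⁻¹) x :=
  (contDiffAt_norm ℝ hx).inv (norm_ne_zero_iff.2 hx)

lemma dirDeriv_comp_of_hasDerivAt {φ : ℝ → ℝ} {F : E → ℝ} {x : E} {c : ℝ}
    (hφ : HasDerivAt φ c (F x)) (hF : DifferentiableAt ℝ F x) (a : E) :
    dirDeriv a (fun y => φ (F y)) x = c * dirDeriv a F x := by
  rw [dirDeriv_comp hφ.differentiableAt hF, hφ.deriv]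

variable [FiniteDimensional ℝ E]

lemma lap_comp {φ φ' : ℝ → ℝ} {F : E → ℝ} {x : E} {c : ℝ} (hF : ContDiffAt ℝ ∞ F x)
    (h1 : ∀ᶠ s in 𝓝 (F x), HasDerivAt φ (φ' s) s) (h2 : HasDerivAt φ' c (F x)) :
    lap (fun y => φ (F y)) x = φ' (F x) * lap F x +
      c * ∑ i, dirDeriv (stdOrthonormalBasis ℝ E i) F x ^ 2 := by
  simp only [lap, Finset.mul_sum, ← Finset.sum_add_distrib]
  refine Finset.sum_congr rfl fun i _ => ?_
  set a := stdOrthonormalBasis ℝ E i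
  have h : dirDeriv a (fun y => φ (F y)) =ᶠ[𝓝 x] fun y => φ' (F y) * dirDeriv a F y := by
    filter_upwards [ContDiffAt.eventually_differentiableAt hF,
      hF.continuousAt.eventually h1] with y hy1 hy2
    exact dirDeriv_comp_of_hasDerivAt hy2 hy1 a
  have hF0 := hF.differentiableAt (by simp)
  rw [(dirDeriv_congr h a).self_of_nhds, dirDeriv_mul (F := fun y => φ' (F y))
    (h2.differentiableAt.comp x hF0) ((contDiffAt_dirDeriv hF a).differentiableAt (by simp)),
    dirDeriv_comp_of_hasDerivAt h2 hF0]
  ring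

lemma lap_inv_norm {n : ℕ} (hn : finrank ℝ E = n + 1) {x : E} (hx : x ≠ 0) :
    lap (fun y : E => ‖y‖⁻¹) x = (2 - n) * ‖x‖⁻¹ ^ 3 := by
  have key : ∀ a : E, dirDeriv a (dirDeriv a fun y : E => ‖y‖⁻¹) x =
      -⟪a, a⟫ * ‖x‖⁻¹ ^ 3 + 3 * ‖x‖⁻¹ ^ 5 * (⟪x, a⟫ * ⟪a, x⟫) := by
    intro a
    have h : dirDeriv a (fun y : E => ‖y‖⁻¹) =ᶠ[𝓝 x] fun y => (-1) * (⟪a, y⟫ * ‖y‖⁻¹ ^ 3) := by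
      filter_upwards [isOpen_ne_zero.mem_nhds hx] with y hy
      rw [dirDeriv_inv_norm hy, real_inner_comm y a]
      ring
    have hN := (contDiffAt_inv_norm hx (k := 1)).differentiableAt one_ne_zero
    rw [(dirDeriv_congr h a).self_of_nhds, dirDeriv_const_mul, dirDeriv_mul (F := fun y => ⟪a, y⟫)
      (G := fun y => ‖y‖⁻¹ ^ 3) (innerSL ℝ a).differentiableAt (hN.pow 3), dirDeriv_inner,
      dirDeriv_comp_of_hasDerivAt (φ := fun s => s ^ 3) (hasDerivAt_pow 3 _) hN,
      dirDeriv_inv_norm hx, real_inner_comm x a]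
    push_cast
    ring
  simp only [lap, key, Finset.sum_add_distrib, ← Finset.mul_sum,
    OrthonormalBasis.sum_inner_mul_inner, real_inner_self_eq_norm_sq,
    OrthonormalBasis.norm_eq_one]
  have : ‖x‖ ≠ 0 := norm_ne_zero_iff.2 hx
  simp [hn]
  field_simp
  ring

namespace SphereFun

open Classical in
/-- Composition with a function of one real variable. -/
def comp (φ : ℝ → ℝ) (F : SphereFun E) (h : ∀ x, x ≠ 0 → ContDiffAt ℝ ∞ φ (F x)) : SphereFun E :=
  ⟨fun x => if x = 0 then 0 else φ (F x), by
    have h1 : ContDiffOn ℝ ∞ (fun x => φ (F x)) {0}ᶜ := fun x hx =>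
      ((h x hx).comp x (F.contDiffAt hx)).contDiffWithinAt
    exact h1.congr fun x hx => if_neg hx, fun r hr x => by
      simp [hr.ne', F.smul_apply_pos hr], by simp⟩

lemma comp_apply (φ : ℝ → ℝ) (F : SphereFun E) (h : ∀ x, x ≠ 0 → ContDiffAt ℝ ∞ φ (F x)) {x : E}
    (hx : x ≠ 0) : comp φ F h x = φ (F x) := if_neg hx

lemma comp_eventuallyEq (φ : ℝ → ℝ) (F : SphereFun E) (h : ∀ x, x ≠ 0 → ContDiffAt ℝ ∞ φ (F x))
    {x : E} (hx : x ≠ 0) : comp φ F h =ᶠ[𝓝 x] fun y => φ (F y) := by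
  filter_upwards [isOpen_ne_zero.mem_nhds hx] with y hy using comp_apply φ F h hy

lemma rot_comp_apply {φ : ℝ → ℝ} {F : SphereFun E} (h : ∀ x, x ≠ 0 → ContDiffAt ℝ ∞ φ (F x))
    (p v : E) {x : E} (hx : x ≠ 0) {c : ℝ} (hφ : HasDerivAt φ c (F x)) :
    rot p v (comp φ F h) x = c * rot p v F x := by
  have h1 : ∀ a, dirDeriv a (comp φ F h) x = c * dirDeriv a F x := fun a => by
    rw [(dirDeriv_congr (comp_eventuallyEq φ F h hx) a).self_of_nhds,
      dirDeriv_comp_of_hasDerivAt hφ (F.differentiableAt hx)]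
  rw [rot_apply, rot_apply, h1, h1]
  ring

/-- The restriction of a linear function to the sphere. -/
def coord (a : E) : SphereFun E :=
  ⟨fun x => ⟪a, x⟫ * ‖x‖⁻¹, fun x hx =>
    (((innerSL ℝ a).contDiff.contDiffAt).mul (contDiffAt_inv_norm hx)).contDiffWithinAt,
    fun r hr x => by
      simp only [inner_smul_right, norm_smul, Real.norm_eq_abs, abs_of_pos hr, mul_inv]
      field_simp, by simp⟩

lemma coord_apply (a x : E) : coord a x = ⟪a, x⟫ * ‖x‖⁻¹ := rfl

lemma dirDeriv_coord (p a : E) {x : E} (hx : x ≠ 0) :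
    dirDeriv a (coord p) x = ⟪p, a⟫ * ‖x‖⁻¹ - ⟪p, x⟫ * ⟪x, a⟫ * ‖x‖⁻¹ ^ 3 := by
  have := dirDeriv_mul (F := fun y => ⟪p, y⟫) (G := fun y => ‖y‖⁻¹) (innerSL ℝ p).differentiableAt
    ((contDiffAt_inv_norm hx (k := 1)).differentiableAt one_ne_zero) a
  rw [dirDeriv_inner, dirDeriv_inv_norm hx] at this
  rw [show dirDeriv a (coord p) x = dirDeriv a (fun y => ⟪p, y⟫ * ‖y‖⁻¹) x from rfl, this]
  ring

lemma rot_coord (p v a : E) : rot p v (coord a) = ⟪a, p⟫ • coord v - ⟪a, v⟫ • coord p := by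
  ext x hx
  simp only [rot_apply, dirDeriv_coord _ _ hx, coe_sub, coe_smul, coord_apply,
    real_inner_comm p x, real_inner_comm v x]
  ring

lemma sLap_coord {n : ℕ} (hn : finrank ℝ E = n + 1) (p : E) :
    sLap (coord p) = -(n : ℝ) • coord p := by
  ext x hx
  have hx' := norm_ne_zero_iff.2 hx
  rw [sLap_apply, show lap (coord p) x = lap (fun y => ⟪p, y⟫ * ‖y‖⁻¹) x from rfl,
    lap_inner_mul (contDiffAt_inv_norm hx), lap_inv_norm hn hx, dirDeriv_inv_norm hx, coe_smul,
    coord_apply, real_inner_comm p x]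
  field_simp
  ring

/-- On the unit sphere the gradient of the height function is the tangential projection of `p`. -/
lemma sum_dirDeriv_coord_sq {p : E} (hp : ‖p‖ = 1) {x : E} (hx : x ≠ 0) :
    ‖x‖ ^ 2 * ∑ i, dirDeriv (stdOrthonormalBasis ℝ E i) (coord p) x ^ 2 = 1 - coord p x ^ 2 := by
  have hx' := norm_ne_zero_iff.2 hx
  set b := stdOrthonormalBasis ℝ E
  have key : ∀ i, dirDeriv (b i) (coord p) x ^ 2 = ‖x‖⁻¹ ^ 2 * (⟪p, b i⟫ * ⟪b i, p⟫) -
      2 * ⟪p, x⟫ * ‖x‖⁻¹ ^ 4 * (⟪p, b i⟫ * ⟪b i, x⟫) +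
        ⟪p, x⟫ ^ 2 * ‖x‖⁻¹ ^ 6 * (⟪x, b i⟫ * ⟪b i, x⟫) := fun i => by
    rw [dirDeriv_coord _ _ hx, real_inner_comm (b i) p, real_inner_comm (b i) x]
    ring
  simp only [key, Finset.sum_add_distrib, Finset.sum_sub_distrib, ← Finset.mul_sum,
    OrthonormalBasis.sum_inner_mul_inner, real_inner_self_eq_norm_sq, hp, coord_apply]
  field_simp
  ring

lemma abs_coord_le {p : E} (hp : ‖p‖ = 1) (x : E) : |coord p x| ≤ 1 := by
  rcases eq_or_ne x 0 with rfl | hx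
  · simp
  · have hx' := norm_pos_iff.2 hx
    rw [coord_apply, abs_mul, abs_of_pos (inv_pos.2 hx'), ← div_eq_mul_inv, div_le_one hx']
    simpa [hp] using abs_real_inner_le_norm p x

lemma coord_lt {p : E} (hp : ‖p‖ = 1) {l : ℝ} (hl : 1 < l) (x : E) : coord p x < l :=
  ((le_abs_self _).trans (abs_coord_le hp x)).trans_lt hl

lemma sLap_comp_coord_apply {n : ℕ} (hn : finrank ℝ E = n + 1) {p : E} (hp : ‖p‖ = 1)
    {φ φ' : ℝ → ℝ} (h : ∀ x, x ≠ 0 → ContDiffAt ℝ ∞ φ (coord p x)) {x : E} (hx : x ≠ 0) {c : ℝ}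
    (h1 : ∀ᶠ s in 𝓝 (coord p x), HasDerivAt φ (φ' s) s) (h2 : HasDerivAt φ' c (coord p x)) :
    sLap (comp φ (coord p) h) x =
      c * (1 - coord p x ^ 2) - n * coord p x * φ' (coord p x) := by
  rw [sLap_apply, lap_congr (comp_eventuallyEq _ _ h hx), lap_comp ((coord p).contDiffAt hx) h1 h2,
    ← sum_dirDeriv_coord_sq hp hx]
  have := congrArg (fun F : SphereFun E => F x) (sLap_coord hn p)
  simp only [sLap_apply, coe_smul] at this
  linear_combination φ' (coord p x) * this

/-- The kernel `(l - ⟪p, x⟫)⁻ᵏ` on the unit sphere. -/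
def invKernel {p : E} (hp : ‖p‖ = 1) {l : ℝ} (hl : 1 < l) (k : ℕ) : SphereFun E :=
  comp (fun t => (l - t)⁻¹ ^ k) (coord p) fun x _ =>
    ((contDiffAt_const.sub contDiffAt_id).inv (sub_pos.2 (coord_lt hp hl x)).ne').pow k

/-- The kernel `log (l - ⟪p, x⟫)` on the unit sphere. -/
def logKernel {p : E} (hp : ‖p‖ = 1) {l : ℝ} (hl : 1 < l) : SphereFun E :=
  comp (fun t => Real.log (l - t)) (coord p) fun x _ =>
    (contDiffAt_const.sub contDiffAt_id).log (sub_pos.2 (coord_lt hp hl x)).ne'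

/-! ### Action of the spherical Laplacian and of rotations on the kernels -/

section Kernel

variable {p : E} (hp : ‖p‖ = 1) {l : ℝ} (hl : 1 < l)

lemma invKernel_apply (k : ℕ) {x : E} (hx : x ≠ 0) :
    invKernel hp hl k x = (l - coord p x)⁻¹ ^ k := comp_apply _ _ _ hx

include hl hp in
lemma sub_coord_pos (x : E) : 0 < l - coord p x := sub_pos.2 (coord_lt hp hl x)

lemma hasDerivAt_inv_pow {l t : ℝ} (h : t < l) (k : ℕ) :
    HasDerivAt (fun t => (l - t)⁻¹ ^ k) (k * (l - t)⁻¹ ^ (k + 1)) t := by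
  have h0 : l - t ≠ 0 := (sub_pos.2 h).ne'
  have h1 : HasDerivAt (fun t => (l - t)⁻¹) ((l - t)⁻¹ ^ 2) t :=
    (((hasDerivAt_id t).const_sub l).inv h0).congr_deriv (by simp)
  refine (h1.pow k).congr_deriv ?_
  rcases k with _ | k
  · simp
  · simp only [Nat.add_sub_cancel]
    ring

lemma hasDerivAt_log_sub {l t : ℝ} (h : t < l) :
    HasDerivAt (fun t => Real.log (l - t)) (-(l - t)⁻¹ ^ 1) t :=
  (((hasDerivAt_id t).const_sub l).log (sub_pos.2 h).ne').congr_deriv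
    (by simp [div_eq_mul_inv])

/-- With `z = l - t` one has `1 - t² = (1 - l²) + 2lz - z²`; the constant `k (n - 1 - k)` is exactly
what cancels the `z⁻ᵏ` term. The coefficient `n - 2 - 2k` vanishes at `k = n/2 - 1`, the index of
the last factor of `P_n`. -/
lemma sLap_invKernel {n : ℕ} (hn : finrank ℝ E = n + 1) (k : ℕ) :
    -sLap (invKernel hp hl k) + ((k : ℝ) * (n - 1 - k)) • invKernel hp hl k =
      (k * (n - 2 - 2 * k) * l) • invKernel hp hl (k + 1) +
        (k * (k + 1) * (l ^ 2 - 1)) • invKernel hp hl (k + 2) := by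
  ext x hx
  have hz := (sub_coord_pos hp hl x).ne'
  have hev : ∀ᶠ s in 𝓝 (coord p x), s < l := gt_mem_nhds (coord_lt hp hl x)
  have h := sLap_comp_coord_apply hn hp (φ := fun t => (l - t)⁻¹ ^ k)
    (fun x _ => ((contDiffAt_const.sub contDiffAt_id).inv (sub_pos.2 (coord_lt hp hl x)).ne').pow k)
    hx (hev.mono fun s hs => hasDerivAt_inv_pow hs k)
    ((hasDerivAt_inv_pow (coord_lt hp hl x) (k + 1)).const_mul (k : ℝ))
  simp only [coe_add, coe_neg, coe_smul, invKernel_apply hp hl _ hx]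
  rw [invKernel, h]
  have e : coord p x = l - (l - coord p x) := by ring
  set z := l - coord p x with hzdef
  rw [e, inv_pow, inv_pow, inv_pow, pow_succ z (k + 1), pow_succ z k]
  push_cast
  field_simp
  ring

/-- The bottom rung of the same ladder. The constant `n - 1` survives here, and it carries the value
at `p` in the Green's formula. -/
lemma sLap_logKernel {n : ℕ} (hn : finrank ℝ E = n + 1) :
    sLap (logKernel hp hl) = ((n - 2) * l) • invKernel hp hl 1 +
      (l ^ 2 - 1) • invKernel hp hl 2 - const ((n : ℝ) - 1) := by
  ext x hx
  have hz := (sub_coord_pos hp hl x).ne'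
  have hev : ∀ᶠ s in 𝓝 (coord p x), s < l := gt_mem_nhds (coord_lt hp hl x)
  have h := sLap_comp_coord_apply hn hp (φ := fun t => Real.log (l - t))
    (fun x _ => (contDiffAt_const.sub contDiffAt_id).log (sub_pos.2 (coord_lt hp hl x)).ne')
    hx (hev.mono fun s hs => hasDerivAt_log_sub hs)
    (hasDerivAt_inv_pow (coord_lt hp hl x) 1).neg
  simp only [coe_add, coe_sub, coe_smul, invKernel_apply hp hl _ hx, const_apply _ hx]
  rw [logKernel, h]
  have e : coord p x = l - (l - coord p x) := by ring
  set z := l - coord p x with hzdef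
  rw [e]
  push_cast
  field_simp
  ring

variable {v : E} (hv : ‖v‖ = 1) (hpv : ⟪p, v⟫ = 0)

include hpv in
lemma rot_logKernel : rot p v (logKernel hp hl) = -(coord v * invKernel hp hl 1) := by
  ext x hx
  rw [logKernel, rot_comp_apply _ _ _ hx (hasDerivAt_log_sub (coord_lt hp hl x)), rot_coord]
  simp only [coe_sub, coe_smul, coe_neg, coe_mul, invKernel_apply hp hl _ hx, hpv,
    real_inner_self_eq_norm_sq, hp]
  ring

include hpv hv in
lemma rot_rot_logKernel : rot p v (rot p v (logKernel hp hl)) =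
    coord p * invKernel hp hl 1 - coord v * coord v * invKernel hp hl 2 := by
  ext x hx
  have h : rot p v (invKernel hp hl 1) x = (l - coord p x)⁻¹ ^ 2 * coord v x := by
    rw [invKernel, rot_comp_apply _ _ _ hx (hasDerivAt_inv_pow (coord_lt hp hl x) 1), rot_coord]
    simp [hpv, hp]
  rw [rot_logKernel hp hl hpv, map_neg, rot_mul]
  have hvp : ⟪v, p⟫ = 0 := by rw [real_inner_comm, hpv]
  simp only [coe_neg, coe_add, coe_mul, coe_sub, rot_coord, h, coe_smul, hvp,
    invKernel_apply hp hl _ hx, real_inner_self_eq_norm_sq, hv]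
  ring

end Kernel

end SphereFun

end Zonal

/-! ### Moments of the inverse power kernels -/

section Moments

variable {E : Type*} [NormedAddCommGroup E] [InnerProductSpace ℝ E] [FiniteDimensional ℝ E]
  [MeasurableSpace E] [BorelSpace E]

namespace SphereFun

lemma avg_sLap (F : SphereFun E) : avg (sLap F) = 0 := by
  have h : sLap F = sLap F * const 1 := by
    ext x hx
    rw [coe_mul, const_apply _ hx, mul_one]
  have h2 : F * (0 : SphereFun E) = 0 := by
    ext x hx
    simp
  rw [h, avg_sLap_mul, sLap_const, h2, map_zero]

lemma avg_nonneg {F : SphereFun E} (h : ∀ x, ‖x‖ = 1 → 0 ≤ F x) : 0 ≤ avg F := by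
  simpa using avg_mono (F := 0) h

lemma ne_zero_of_norm_eq_one {x : E} (hx : ‖x‖ = 1) : x ≠ 0 := by
  rintro rfl
  simp at hx

lemma exists_bound (F : SphereFun E) : ∃ K, 0 ≤ K ∧ ∀ x, ‖x‖ = 1 → |F x| ≤ K := by
  have hc : ContinuousOn F (Metric.sphere (0 : E) 1) := fun x hx =>
    (F.contDiffAt (ne_zero_of_norm_eq_one (by simpa using hx))).continuousAt.continuousWithinAt
  obtain ⟨K, hK⟩ := (isCompact_sphere (0 : E) 1).exists_bound_of_continuousOn hc
  exact ⟨max K 0, le_max_right _ _, fun x hx => (hK x (by simpa using hx)).trans (le_max_left _ _)⟩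

lemma avg_const (c : ℝ) : avg (const c : SphereFun E) = c * avg (const 1 : SphereFun E) := by
  rw [← smul_eq_mul, ← map_smul]
  congr 1
  ext x hx
  simp [const_apply _ hx]

section

variable {p : E} (hp : ‖p‖ = 1) {l : ℝ} (hl : 1 < l)

lemma invKernel_nonneg (k : ℕ) {x : E} (hx : x ≠ 0) : 0 ≤ invKernel hp hl k x := by
  rw [invKernel_apply hp hl k hx]
  exact pow_nonneg (inv_nonneg.2 (sub_coord_pos hp hl x).le) _

lemma moment_nonneg (k : ℕ) : 0 ≤ avg (invKernel hp hl k) :=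
  avg_nonneg fun _ hx => invKernel_nonneg hp hl k (ne_zero_of_norm_eq_one hx)

lemma abs_avg_invKernel_mul_le (k : ℕ) {F G : SphereFun E} (h : ∀ x, ‖x‖ = 1 → |F x| ≤ G x) :
    |avg (invKernel hp hl k * F)| ≤ avg (invKernel hp hl k * G) := by
  rw [abs_le, ← map_neg]
  constructor <;> refine avg_mono fun x hx => ?_
  all_goals
    have h1 := invKernel_nonneg hp hl k (ne_zero_of_norm_eq_one hx)
    have h2 := abs_le.1 (h x hx)
    simp only [coe_neg, coe_mul]
    nlinarith [mul_le_mul_of_nonneg_left h2.1 h1, mul_le_mul_of_nonneg_left h2.2 h1]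

lemma invKernel_zero : invKernel hp hl 0 = const 1 := by
  ext x hx
  rw [invKernel_apply hp hl 0 hx, const_apply _ hx, pow_zero]

lemma mul_const_eq_smul (F : SphereFun E) (c : ℝ) : F * const c = c • F := by
  ext x hx
  rw [coe_mul, const_apply _ hx, coe_smul, mul_comm]

variable {m : ℕ} (hm : 1 ≤ m) (hn : finrank ℝ E = (2 * m + 2) + 1)

include hn

/-- The average of `sLap_invKernel`, divided by `k`: Laplacians have average zero. -/
lemma moment_rec {k : ℕ} (hk : 1 ≤ k) : (2 * m + 1 - k) * avg (invKernel hp hl k) =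
    2 * (m - k) * l * avg (invKernel hp hl (k + 1)) +
      (k + 1) * (l ^ 2 - 1) * avg (invKernel hp hl (k + 2)) := by
  have h := congrArg avg (sLap_invKernel hp hl hn k)
  simp only [map_add, map_neg, map_smul, avg_sLap, smul_eq_mul] at h
  push_cast at h
  have hk' : (k : ℝ) ≠ 0 := by positivity
  apply mul_left_cancel₀ hk'
  linear_combination h

lemma moment_one : 2 * m * l * avg (invKernel hp hl 1) + (l ^ 2 - 1) * avg (invKernel hp hl 2) =
    (2 * m + 1) * avg (const 1 : SphereFun E) := by
  have h := congrArg avg (sLap_logKernel hp hl hn)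
  simp only [map_add, map_sub, map_smul, avg_sLap, smul_eq_mul] at h
  rw [avg_const] at h
  push_cast at h
  linear_combination -h

include hm

/-- The bound is uniform in `l`. In the recursion for `k < m` the coefficient `2 (m - k) l` is at
least `1` and the last term is non-negative, so each moment is at most `2m + 1` times the previous
one. -/
lemma moment_le {k : ℕ} (hk : k ≤ m) :
    avg (invKernel hp hl k) ≤ (2 * m + 1) ^ k * avg (const 1 : SphereFun E) := by
  have hm' : (1 : ℝ) ≤ m := by exact_mod_cast hm
  have hl2 : 0 ≤ l ^ 2 - 1 := by nlinarith
  induction k with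
  | zero => simp [invKernel_zero]
  | succ k ih =>
    have ih := ih (by omega)
    have h1 := moment_nonneg hp hl (k + 1)
    have h2 := mul_nonneg hl2 (moment_nonneg hp hl (k + 2))
    have hk' : (k : ℝ) + 1 ≤ m := by exact_mod_cast hk
    have hc : 1 ≤ 2 * ((m : ℝ) - k) * l := by nlinarith
    have h3 : avg (invKernel hp hl (k + 1)) ≤ (2 * m + 1) * avg (invKernel hp hl k) := by
      rcases Nat.eq_zero_or_pos k with rfl | hk0
      · have := moment_one hp hl hn
        rw [invKernel_zero]
        push_cast at hc
        simp only [zero_add] at *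
        nlinarith [mul_le_mul_of_nonneg_right hc h1]
      · have := moment_rec hp hl hn hk0
        have h4 : 0 ≤ (k : ℝ) * avg (invKernel hp hl k) :=
          mul_nonneg (by positivity) (moment_nonneg hp hl k)
        have h5 := mul_le_mul_of_nonneg_right hc h1
        have h6 : 0 ≤ (k + 1) * (l ^ 2 - 1) * avg (invKernel hp hl (k + 2)) := by
          rw [mul_assoc]; positivity
        nlinarith
    calc _ ≤ _ := h3
      _ ≤ (2 * m + 1) * ((2 * m + 1) ^ k * avg (const 1 : SphereFun E)) :=
        mul_le_mul_of_nonneg_left ih (by positivity)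
      _ = _ := by ring

/-- At `k = m` the middle term of the recursion disappears. Thus the concentrating kernels have
bounded mass. -/
lemma moment_top : (l ^ 2 - 1) * avg (invKernel hp hl (m + 2)) = avg (invKernel hp hl m) := by
  have h := moment_rec hp hl hn hm
  have hm' : (m : ℝ) + 1 ≠ 0 := by positivity
  apply mul_left_cancel₀ hm'
  linear_combination -h

omit hm in
-- Interpolation between the two neighbouring moments, needed because the recursion gives no direct
-- bound at `m + 1`. Pointwise it is `u ≤ δu² + δ⁻¹`.
lemma moment_le_add {δ : ℝ} (hδ : 0 < δ) : avg (invKernel hp hl (m + 1)) ≤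
    δ * avg (invKernel hp hl (m + 2)) + δ⁻¹ * avg (invKernel hp hl m) := by
  rw [← smul_eq_mul, ← smul_eq_mul, ← map_smul, ← map_smul, ← map_add]
  refine avg_mono fun x hx => ?_
  have hx0 := ne_zero_of_norm_eq_one hx
  simp only [coe_add, coe_smul, invKernel_apply hp hl _ hx0]
  have hu : 0 ≤ (l - coord p x)⁻¹ := inv_nonneg.2 (sub_coord_pos hp hl x).le
  set u := (l - coord p x)⁻¹
  have h : 0 ≤ u ^ m * (δ⁻¹ * ((δ * u - 1) ^ 2 + δ * u)) := by positivity
  have h' : u ^ m * (δ⁻¹ * ((δ * u - 1) ^ 2 + δ * u)) =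
      δ * u ^ (m + 2) + δ⁻¹ * u ^ m - u ^ (m + 1) := by
    field_simp
    ring
  linarith

end

/-! ### Limits as the kernels become singular -/

section Limits

variable {p : E} (hp : ‖p‖ = 1) {l : ℕ → ℝ} (hl : ∀ j, 1 < l j) (hlim : Tendsto l atTop (𝓝 1))
  {m : ℕ} (hm : 1 ≤ m) (hn : finrank ℝ E = (2 * m + 2) + 1)

include hlim in
lemma tendsto_sq_sub_one : Tendsto (fun j => l j ^ 2 - 1) atTop (𝓝 0) := by
  have := (hlim.pow 2).sub_const 1
  simpa using this

include hlim hm hn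

lemma tendsto_moment {k : ℕ} (hk : k ≤ m + 1) :
    Tendsto (fun j => (l j ^ 2 - 1) * avg (invKernel hp (hl j) k)) atTop (𝓝 0) := by
  have hl2 : ∀ j, 0 < l j ^ 2 - 1 := fun j => by nlinarith [hl j]
  have h0 : ∀ j, 0 ≤ (l j ^ 2 - 1) * avg (invKernel hp (hl j) k) := fun j =>
    mul_nonneg (hl2 j).le (moment_nonneg hp (hl j) k)
  have hs := tendsto_sq_sub_one hlim
  rcases Nat.lt_or_ge m k with h | h
  · obtain rfl : k = m + 1 := by omega
    set C := (2 * m + 1) ^ m * avg (const 1 : SphereFun E)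
    have hs' : Tendsto (fun j => 2 * C * Real.sqrt (l j ^ 2 - 1)) atTop (𝓝 0) := by
      have := (hs.sqrt).const_mul (2 * C)
      simpa using this
    refine squeeze_zero h0 (fun j => ?_) hs'
    -- This choice balances the two terms: after multiplication by `l² - 1 = δ²`, each equals `δ`
    -- times the bounded moment `m`.
    set δ := Real.sqrt (l j ^ 2 - 1)
    have hδ : 0 < δ := Real.sqrt_pos.2 (hl2 j)
    have hδ2 : l j ^ 2 - 1 = δ ^ 2 := (Real.sq_sqrt (hl2 j).le).symm
    have h1 := moment_le_add hp (hl j) hn hδ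
    have h2 := moment_top hp (hl j) hm hn
    have h3 := moment_le hp (hl j) hm hn le_rfl
    rw [hδ2] at h2 ⊢
    calc δ ^ 2 * avg (invKernel hp (hl j) (m + 1)) ≤ δ ^ 2 *
          (δ * avg (invKernel hp (hl j) (m + 2)) + δ⁻¹ * avg (invKernel hp (hl j) m)) :=
        mul_le_mul_of_nonneg_left h1 (by positivity)
      _ = δ * (δ ^ 2 * avg (invKernel hp (hl j) (m + 2))) + δ * avg (invKernel hp (hl j) m) := by
        field_simp
      _ = 2 * δ * avg (invKernel hp (hl j) m) := by rw [h2]; ring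
      _ ≤ 2 * δ * C := mul_le_mul_of_nonneg_left h3 (by positivity)
      _ = 2 * C * δ := by ring
  · have := hs.mul_const ((2 * m + 1) ^ k * avg (const 1 : SphereFun E))
    rw [zero_mul] at this
    exact squeeze_zero h0 (fun j => mul_le_mul_of_nonneg_left
      (moment_le hp (hl j) hm hn h) (hl2 j).le) this

lemma tendsto_invKernel_mul {k : ℕ} (hk : k ≤ m + 1) (F : SphereFun E) :
    Tendsto (fun j => (l j ^ 2 - 1) * avg (invKernel hp (hl j) k * F)) atTop (𝓝 0) := by
  obtain ⟨K, hK, hF⟩ := F.exists_bound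
  have h := (tendsto_moment hp hl hlim hm hn hk).const_mul K
  rw [mul_zero] at h
  refine squeeze_zero_norm (fun j => ?_) h
  have h1 := abs_avg_invKernel_mul_le hp (hl j) k (F := F) (G := const K) fun x hx => by
    rw [const_apply _ (ne_zero_of_norm_eq_one hx)]
    exact hF x hx
  rw [mul_const_eq_smul, map_smul, smul_eq_mul] at h1
  have hl2 : 0 ≤ l j ^ 2 - 1 := by nlinarith [hl j]
  rw [Real.norm_eq_abs, abs_mul, abs_of_nonneg hl2]
  nlinarith [mul_le_mul_of_nonneg_left h1 hl2]

omit hlim hm hn in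
include hp in
-- Near `p` continuity gives `ε`; away from `p` the function is bounded, and `1 - ⟪p, x⟫ = ‖x - p‖²
-- / 2` is bounded below.
lemma exists_abs_le_add_mul (F : SphereFun E) (hF : F p = 0) {ε : ℝ} (hε : 0 < ε) :
    ∃ C, 0 ≤ C ∧ ∀ x, ‖x‖ = 1 → |F x| ≤ ε + C * (1 - coord p x) := by
  obtain ⟨K, hK, hFK⟩ := F.exists_bound
  have hc : ContinuousAt F p := (F.contDiffAt (ne_zero_of_norm_eq_one hp)).continuousAt
  obtain ⟨r, hr, h⟩ := Metric.continuousAt_iff.1 hc ε hε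
  refine ⟨2 * K / r ^ 2, by positivity, fun x hx => ?_⟩
  have ht : ‖x - p‖ ^ 2 = 2 * (1 - coord p x) := by
    rw [norm_sub_sq_real, hx, hp, coord_apply, hx, real_inner_comm p x]
    ring
  have ht0 : 0 ≤ 1 - coord p x := by nlinarith [sq_nonneg ‖x - p‖]
  rcases lt_or_ge (dist x p) r with hd | hd
  · have := h hd
    rw [hF, dist_zero_right, Real.norm_eq_abs] at this
    have h2 : 0 ≤ 2 * K / r ^ 2 * (1 - coord p x) := mul_nonneg (by positivity) ht0
    linarith
  · rw [dist_eq_norm] at hd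
    have h3 : r ^ 2 ≤ 2 * (1 - coord p x) := by
      rw [← ht]
      exact pow_le_pow_left₀ hr.le hd 2
    have h4 : K ≤ 2 * K / r ^ 2 * (1 - coord p x) := by
      rw [div_mul_eq_mul_div, le_div_iff₀ (by positivity)]
      nlinarith [mul_le_mul_of_nonneg_left h3 hK]
    linarith [hFK x hx]

/-- The kernels `(l² - 1) (l - ⟪p, x⟫)⁻ᵐ⁻²` concentrate at `p`. -/
lemma tendsto_concentrate (F : SphereFun E) (hF : F p = 0) :
    Tendsto (fun j => (l j ^ 2 - 1) * avg (invKernel hp (hl j) (m + 2) * F)) atTop (𝓝 0) := by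
  rw [Metric.tendsto_atTop]
  intro ε hε
  set A := (2 * m + 1) ^ m * avg (const 1 : SphereFun E)
  have hA : 0 ≤ A := mul_nonneg (by positivity)
    (avg_nonneg fun x hx => by rw [const_apply _ (ne_zero_of_norm_eq_one hx)]; exact zero_le_one)
  -- `A` bounds the mass of the kernels, by `moment_top` and `moment_le`; `A + 1` keeps the
  -- denominator positive.
  have hε' : 0 < ε / (2 * (A + 1)) := by positivity
  obtain ⟨C, hC, hb⟩ := exists_abs_le_add_mul hp F hF hε'
  have h1 := (tendsto_moment hp hl hlim hm hn le_rfl).const_mul C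
  rw [mul_zero] at h1
  obtain ⟨N, hN⟩ := eventually_atTop.1 (h1.eventually (gt_mem_nhds (half_pos hε)))
  refine ⟨N, fun j hj => ?_⟩
  have hl2 : 0 ≤ l j ^ 2 - 1 := by nlinarith [hl j]
  have h2 : avg (invKernel hp (hl j) (m + 2) *
      (const (ε / (2 * (A + 1))) + C • (const 1 - coord p))) ≤
      ε / (2 * (A + 1)) * avg (invKernel hp (hl j) (m + 2)) +
        C * avg (invKernel hp (hl j) (m + 1)) := by
    rw [show ε / (2 * (A + 1)) * avg (invKernel hp (hl j) (m + 2)) +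
        C * avg (invKernel hp (hl j) (m + 1)) = avg ((ε / (2 * (A + 1))) •
        invKernel hp (hl j) (m + 2) + C • invKernel hp (hl j) (m + 1)) by
      simp only [map_add, map_smul, smul_eq_mul]]
    refine avg_mono fun x hx => ?_
    have hx0 := ne_zero_of_norm_eq_one hx
    simp only [coe_mul, coe_add, coe_smul, coe_sub, const_apply _ hx0, invKernel_apply hp _ _ hx0]
    have hz := sub_coord_pos hp (hl j) x
    set z := l j - coord p x with hzdef
    have h3 : z⁻¹ ^ (m + 1) = z⁻¹ ^ (m + 2) * z := by
      rw [pow_succ z⁻¹ (m + 1), mul_assoc, inv_mul_cancel₀ hz.ne', mul_one]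
    have h4 : 0 ≤ z⁻¹ ^ (m + 2) := by positivity
    -- The factor `1 - ⟪p, x⟫` costs one power of the kernel, which leaves the negligible moment `m
    -- + 1`.
    have h5 : 1 - coord p x ≤ z := by rw [hzdef]; linarith [hl j]
    rw [h3]
    nlinarith [mul_le_mul_of_nonneg_left h5 (mul_nonneg hC h4)]
  have h6 := abs_avg_invKernel_mul_le hp (hl j) (m + 2) (F := F)
    (G := const (ε / (2 * (A + 1))) + C • (const 1 - coord p)) fun x hx => by
      simpa [const_apply _ (ne_zero_of_norm_eq_one hx)] using hb x hx
  have h7 := moment_top hp (hl j) hm hn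
  have h8 := moment_le hp (hl j) hm hn le_rfl
  have h9 := hN j hj
  rw [dist_zero_right, Real.norm_eq_abs, abs_mul, abs_of_nonneg hl2]
  calc (l j ^ 2 - 1) * |avg (invKernel hp (hl j) (m + 2) * F)|
      ≤ (l j ^ 2 - 1) * (ε / (2 * (A + 1)) * avg (invKernel hp (hl j) (m + 2)) +
        C * avg (invKernel hp (hl j) (m + 1))) :=
        mul_le_mul_of_nonneg_left (h6.trans h2) hl2
    _ = ε / (2 * (A + 1)) * avg (invKernel hp (hl j) m) +
        C * ((l j ^ 2 - 1) * avg (invKernel hp (hl j) (m + 1))) := by rw [← h7]; ring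
    _ < ε / (2 * (A + 1)) * (A + 1) + ε / 2 :=
        add_lt_add_of_le_of_lt (mul_le_mul_of_nonneg_left (by linarith) hε'.le) h9
    _ = ε := by field_simp; ring

end Limits

end SphereFun

end Moments

/-! ### Polynomials in the spherical Laplacian -/

section PolyOp

variable {E : Type*} [NormedAddCommGroup E] [InnerProductSpace ℝ E] [FiniteDimensional ℝ E]

namespace SphereFun

open Polynomial

/-- The value of a polynomial at the spherical Laplacian. -/
def polyOp (q : ℝ[X]) : SphereFun E →ₗ[ℝ] SphereFun E :=
  aeval (sLap : Module.End ℝ (SphereFun E)) q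

/-- The polynomial `k (n - 1 - k) - X`. -/
def gjmsFactor (n k : ℕ) : ℝ[X] := C ((k : ℝ) * ((n : ℝ) - 1 - k)) - X

/-- The polynomial `∏_{s ≤ k < r} (k (n - 1 - k) - X)`. -/
def gjmsPoly (n s r : ℕ) : ℝ[X] := ∏ k ∈ Finset.Ico s r, gjmsFactor n k

lemma polyOp_mul (q r : ℝ[X]) (F : SphereFun E) : polyOp (q * r) F = polyOp q (polyOp r F) := by
  simp [polyOp]

lemma polyOp_add (q r : ℝ[X]) (F : SphereFun E) : polyOp (q + r) F = polyOp q F + polyOp r F := by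
  simp [polyOp]

lemma polyOp_C (c : ℝ) (F : SphereFun E) : polyOp (C c) F = c • F := by
  simp [polyOp, Algebra.algebraMap_eq_smul_one]

lemma polyOp_X (F : SphereFun E) : polyOp X F = sLap F := by
  simp [polyOp]

lemma polyOp_one (F : SphereFun E) : polyOp 1 F = F := by
  simp [polyOp]

lemma polyOp_gjmsFactor (n k : ℕ) (F : SphereFun E) :
    polyOp (gjmsFactor n k) F = -sLap F + ((k : ℝ) * ((n : ℝ) - 1 - k)) • F := by
  rw [gjmsFactor, sub_eq_add_neg, polyOp_add, polyOp_C, show (-X : ℝ[X]) = C (-1) * X by simp,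
    polyOp_mul, polyOp_X, polyOp_C, neg_one_smul, add_comm]

lemma polyOp_eq (q : ℝ[X]) (F : SphereFun E) :
    polyOp q F = sLap (polyOp q.divX F) + q.eval 0 • F := by
  conv_lhs => rw [← q.divX_mul_X_add, mul_comm, polyOp_add, polyOp_mul, polyOp_X, polyOp_C]
  rw [coeff_zero_eq_eval_zero]

/-- Applied to `T = rot p v` and `T = sLap`, this moves derivatives through the GJMS operator. -/
lemma polyOp_comm (T : SphereFun E →ₗ[ℝ] SphereFun E) (hT : ∀ F, T (sLap F) = sLap (T F))
    (q : ℝ[X]) (F : SphereFun E) : T (polyOp q F) = polyOp q (T F) := by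
  induction q using Polynomial.induction_on' generalizing F with
  | add q r hq hr => rw [polyOp_add, polyOp_add, map_add, hq, hr]
  | monomial k c =>
    rw [← C_mul_X_pow_eq_monomial, polyOp_mul, polyOp_mul, polyOp_C, polyOp_C, map_smul]
    congr 1
    induction k generalizing F with
    | zero => rw [pow_zero, polyOp_one, polyOp_one]
    | succ k ih => rw [pow_succ, polyOp_mul, polyOp_mul, polyOp_X, polyOp_X, ih, hT]

lemma sLap_polyOp_const (q : ℝ[X]) (c : ℝ) : sLap (polyOp q (const c : SphereFun E)) = 0 := by
  rw [polyOp_comm sLap (fun _ => rfl), sLap_const, map_zero]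

lemma gjmsPoly_succ_left (n : ℕ) {s r : ℕ} (h : s < r) :
    gjmsPoly n s r = gjmsFactor n s * gjmsPoly n (s + 1) r :=
  Finset.prod_eq_prod_Ico_succ_bot h _

lemma gjmsPoly_succ_right (n r : ℕ) :
    gjmsPoly n 0 (r + 1) = gjmsFactor n r * gjmsPoly n 0 r := by
  rw [gjmsPoly, Finset.prod_Ico_succ_top (Nat.zero_le r), mul_comm]
  rfl

/-- The product of `k (2m + 1 - k)` over `1 ≤ k ≤ m` pairs up the factors of `(2m)!`. This is how
`(n - 1)!` enters the Green's formula. -/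
lemma mul_eval_gjmsPoly (m : ℕ) :
    (2 * m + 1) * (gjmsPoly (2 * m + 2) 1 (m + 1)).eval 0 = ((2 * m + 1).factorial : ℝ) := by
  have h1 : (gjmsPoly (2 * m + 2) 1 (m + 1)).eval 0 = ((2 * m).factorial : ℝ) := by
    rw [gjmsPoly, eval_prod, Finset.prod_Ico_eq_prod_range]
    have h2 := Nat.factorial_mul_descFactorial (show m ≤ 2 * m by omega)
    rw [show 2 * m - m = m by omega, ← Finset.prod_range_add_one_eq_factorial m,
      Nat.descFactorial_eq_prod_range, ← Finset.prod_mul_distrib] at h2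
    rw [← h2, Nat.cast_prod]
    refine Finset.prod_congr (by simp) fun k hk => ?_
    have hk' : k ≤ 2 * m := by have := Finset.mem_range.1 hk; omega
    simp only [gjmsFactor, eval_sub, eval_C, eval_X]
    push_cast [Nat.cast_sub hk']
    ring
  rw [h1, Nat.factorial_succ]
  push_cast
  ring

variable [MeasurableSpace E] [BorelSpace E]

/-- All terms but the constant one lie in the image of `sLap`, which has average zero. -/
lemma avg_polyOp (q : ℝ[X]) (F : SphereFun E) : avg (polyOp q F) = q.eval 0 * avg F := by
  rw [polyOp_eq, map_add, avg_sLap, map_smul, zero_add, smul_eq_mul]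

lemma avg_mul_gjmsFactor (n k : ℕ) (K F : SphereFun E) : avg (K * polyOp (gjmsFactor n k) F) =
    avg (polyOp (gjmsFactor n k) K * F) := by
  have e1 : K * polyOp (gjmsFactor n k) F =
      ((k : ℝ) * ((n : ℝ) - 1 - k)) • (K * F) - K * sLap F := by
    ext x hx
    simp only [polyOp_gjmsFactor, coe_mul, coe_add, coe_neg, coe_smul, coe_sub]
    ring
  have e2 : polyOp (gjmsFactor n k) K * F =
      ((k : ℝ) * ((n : ℝ) - 1 - k)) • (K * F) - sLap K * F := by
    ext x hx
    simp only [polyOp_gjmsFactor, coe_mul, coe_add, coe_neg, coe_smul, coe_sub]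
    ring
  rw [e1, e2, map_sub, map_sub, avg_sLap_mul]

/-! ### The Green's function of the critical GJMS operator -/

section Green

variable {p : E} (hp : ‖p‖ = 1) {l : ℕ → ℝ} (hl : ∀ j, 1 < l j) (hlim : Tendsto l atTop (𝓝 1))
  {m : ℕ} (hm : 1 ≤ m) (hn : finrank ℝ E = (2 * m + 2) + 1)

include hlim hm hn

/-- Descending induction on `s`, with `d = m - s`. Self-adjointness moves the factor of index `s`
onto the kernel, which climbs to the power `s + 1` up to an error carrying `l² - 1`. At `s = m` only
the concentrating kernel remains, and it sees `F p = 0`. -/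
lemma tendsto_invKernel_gjmsPoly (F : SphereFun E) (hF : F p = 0) (d s : ℕ) (hs : 1 ≤ s)
    (hd : s + d = m) :
    Tendsto (fun j => avg (invKernel hp (hl j) s * polyOp (gjmsPoly (2 * m + 2) s (m + 1)) F))
      atTop (𝓝 0) := by
  induction d generalizing s with
  | zero =>
    obtain rfl : s = m := hd
    have h := (tendsto_concentrate hp hl hlim hm hn F hF).const_mul ((s : ℝ) * (s + 1))
    rw [mul_zero] at h
    refine h.congr fun j => ?_
    have h1 : gjmsPoly (2 * s + 2) (s + 1) (s + 1) = 1 := by simp [gjmsPoly]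
    have h2 := sLap_invKernel hp (hl j) hn s
    rw [gjmsPoly_succ_left _ (by omega), h1, mul_one, avg_mul_gjmsFactor, polyOp_gjmsFactor, h2]
    have e : ((s * (((2 * s + 2 : ℕ) : ℝ) - 2 - 2 * s) * l j) • invKernel hp (hl j) (s + 1) +
        (s * (s + 1) * (l j ^ 2 - 1)) • invKernel hp (hl j) (s + 2)) * F =
        ((s : ℝ) * (s + 1) * (l j ^ 2 - 1)) • (invKernel hp (hl j) (s + 2) * F) := by
      ext x hx
      simp only [coe_smul, coe_mul, coe_add]
      push_cast
      ring
    rw [e, map_smul, smul_eq_mul]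
    ring
  | succ d ih =>
    have h1 := ih (s + 1) (by omega) (by omega)
    set G := polyOp (gjmsPoly (2 * m + 2) (s + 1) (m + 1)) F
    have h2 := (tendsto_invKernel_mul hp hl hlim hm hn (show s + 2 ≤ m + 1 by omega) G).const_mul
      ((s : ℝ) * (s + 1))
    have h3 := (hlim.mul h1).const_mul ((s : ℝ) * (2 * m - 2 * s))
    have h4 := h3.add h2
    simp only [mul_zero, add_zero] at h4
    refine h4.congr fun j => ?_
    have h5 := sLap_invKernel hp (hl j) hn s
    rw [gjmsPoly_succ_left _ (by omega), polyOp_mul, avg_mul_gjmsFactor, polyOp_gjmsFactor, h5]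
    have e : ((s * (((2 * m + 2 : ℕ) : ℝ) - 2 - 2 * s) * l j) • invKernel hp (hl j) (s + 1) +
        (s * (s + 1) * (l j ^ 2 - 1)) • invKernel hp (hl j) (s + 2)) * G =
        ((s : ℝ) * (2 * m - 2 * s) * l j) • (invKernel hp (hl j) (s + 1) * G) +
        ((s : ℝ) * (s + 1) * (l j ^ 2 - 1)) • (invKernel hp (hl j) (s + 2) * G) := by
      ext x hx
      simp only [coe_smul, coe_mul, coe_add]
      push_cast
      ring
    rw [e, map_add, map_smul, map_smul, smul_eq_mul, smul_eq_mul]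
    ring

/-- The logarithmic kernel is a Green's function of the critical GJMS operator. -/
lemma tendsto_logKernel_gjmsPoly (F : SphereFun E) (hF : avg F = 0) :
    Tendsto (fun j => avg (logKernel hp (hl j) * polyOp (gjmsPoly (2 * m + 2) 0 (m + 1)) F))
      atTop (𝓝 (-((2 * m + 1).factorial * F p * avg (const 1 : SphereFun E)))) := by
  set q := gjmsPoly (2 * m + 2) 1 (m + 1) with hq
  -- Subtracting the value at `p` makes the kernel terms tend to zero. It does not change the image
  -- under the full operator, whose factor of index `0` kills constants; `F p` comes back only
  -- through the average of `G`.
  set g := F - const (F p) with hg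
  have hp0 := ne_zero_of_norm_eq_one hp
  have hgp : g p = 0 := by rw [hg, coe_sub, const_apply _ hp0, sub_self]
  set G := polyOp q g with hG
  have hP : polyOp (gjmsPoly (2 * m + 2) 0 (m + 1)) F = polyOp (gjmsFactor (2 * m + 2) 0) G := by
    have h1 : sLap (polyOp q F) = sLap G := by
      rw [hG, hg, map_sub, map_sub, sLap_polyOp_const, sub_zero]
    rw [gjmsPoly_succ_left _ (by omega), polyOp_mul, ← hq, polyOp_gjmsFactor, polyOp_gjmsFactor, h1]
    simp
  have hGavg : (2 * m + 1) * avg G =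
      -((2 * m + 1).factorial * F p * avg (const 1 : SphereFun E)) := by
    rw [hG, avg_polyOp, ← mul_assoc, mul_eval_gjmsPoly, hg, map_sub, hF, avg_const]
    ring
  have h1 := (tendsto_invKernel_gjmsPoly hp hl hlim hm hn g hgp (m - 1) 1 le_rfl (by omega))
  have h2 := tendsto_invKernel_mul hp hl hlim hm hn (show 2 ≤ m + 1 by omega) G
  have h3 := (((hlim.mul h1).const_mul (2 * m : ℝ)).add h2).const_sub ((2 * m + 1) * avg G)
  rw [hGavg] at h3
  simp only [mul_zero, add_zero, sub_zero] at h3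
  refine h3.congr fun j => ?_
  have h4 := sLap_logKernel hp (hl j) hn
  rw [← hGavg, hP, avg_mul_gjmsFactor, polyOp_gjmsFactor, h4, ← hq, ← hG]
  have e : (-(((((2 * m + 2 : ℕ) : ℝ) - 2) * l j) • invKernel hp (hl j) 1 +
      (l j ^ 2 - 1) • invKernel hp (hl j) 2 - const (((2 * m + 2 : ℕ) : ℝ) - 1)) +
      (((0 : ℕ) : ℝ) * (((2 * m + 2 : ℕ) : ℝ) - 1 - (0 : ℕ))) • logKernel hp (hl j)) * G =
      (2 * m + 1 : ℝ) • G - ((2 * m * l j) • (invKernel hp (hl j) 1 * G) +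
        (l j ^ 2 - 1) • (invKernel hp (hl j) 2 * G)) := by
    ext x hx
    simp only [coe_smul, coe_mul, coe_add, coe_sub, coe_neg, const_apply _ hx]
    push_cast
    ring
  rw [e, map_sub, map_add, map_smul, map_smul, map_smul]
  simp only [smul_eq_mul]
  ring

end Green

/-! ### The key inequality -/

/-- With `t = ⟪p, x⟫`, `b = ⟪v, x⟫` and `u = (l - t)⁻¹`, the relation `(l - t) u = 1` gives `(l + t)
u = (l² - t²) u²`. The whole expression becomes `N ‖u (x - tp - bv) - ξ‖² + (N + 1) (l² - 1) u²`. -/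
lemma kernel_pointwise_nonneg {p v ξ : E} (hp : ‖p‖ = 1) (hv : ‖v‖ = 1) (hpv : ⟪p, v⟫ = 0)
    (hpξ : ⟪p, ξ⟫ = 0) (hvξ : ⟪v, ξ⟫ = 0) {x : E} (hx : ‖x‖ = 1) {l : ℝ} (hl : 1 < l)
    {N : ℝ} (hN : 0 ≤ N) :
    0 ≤ N * (⟪p, x⟫ * (l - ⟪p, x⟫)⁻¹ - ⟪v, x⟫ * ⟪v, x⟫ * (l - ⟪p, x⟫)⁻¹ ^ 2) +
      (N * l * (l - ⟪p, x⟫)⁻¹ + (l ^ 2 - 1) * (l - ⟪p, x⟫)⁻¹ ^ 2) -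
      N * (2 * ⟪ξ, x⟫ * (l - ⟪p, x⟫)⁻¹ - ‖ξ‖ ^ 2) := by
  have ht : ⟪p, x⟫ ≤ 1 := by simpa [hp, hx] using real_inner_le_norm p x
  set t := ⟪p, x⟫
  set b := ⟪v, x⟫
  set s := ⟪ξ, x⟫
  set u := (l - t)⁻¹ with hu
  have hz : l - t ≠ 0 := by linarith
  have hut : t * u = l * u - 1 := by
    rw [hu]
    field_simp
    ring
  have hq : ‖u • (x - t • p - b • v) - ξ‖ ^ 2 =
      (1 - t ^ 2 - b ^ 2) * u ^ 2 - 2 * s * u + ‖ξ‖ ^ 2 := by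
    simp only [← real_inner_self_eq_norm_sq, inner_sub_left, inner_sub_right, inner_smul_left,
      inner_smul_right, real_inner_comm p x, real_inner_comm v x, real_inner_comm ξ x,
      real_inner_comm p v, real_inner_comm p ξ, real_inner_comm v ξ, hpv, hpξ, hvξ]
    simp only [real_inner_self_eq_norm_sq, hp, hv, hx, RCLike.conj_to_real]
    simp only [t, b, s]
    ring
  have h0 := sq_nonneg ‖u • (x - t • p - b • v) - ξ‖
  rw [hq] at h0
  have hl2 : 0 ≤ (l ^ 2 - 1) * u ^ 2 := mul_nonneg (by nlinarith) (sq_nonneg u)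
  have key : N * (t * u - b * b * u ^ 2) + (N * l * u + (l ^ 2 - 1) * u ^ 2) -
      N * (2 * s * u - ‖ξ‖ ^ 2) = N * ((1 - t ^ 2 - b ^ 2) * u ^ 2 - 2 * s * u + ‖ξ‖ ^ 2) +
      (N + 1) * ((l ^ 2 - 1) * u ^ 2) := by
    linear_combination (N + N * (l * u + t * u - 1)) * hut
  rw [key]
  have := mul_nonneg hN h0
  have := mul_nonneg (show 0 ≤ N + 1 by linarith) hl2
  linarith

/-- The right-hand side, times a positive constant, is a limit of averages of `f ≥ 0` against
non-negative kernels. The condition on `ξ` allows `-‖ξ‖²` to be replaced by `‖ξ‖² - 2 ∂_ξ W`, which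
is affine in `W`. -/
theorem hessian_inequality {m : ℕ} (hm : 1 ≤ m) (hn : finrank ℝ E = (2 * m + 2) + 1)
    (W : SphereFun E)
    (hW : ∀ x, ‖x‖ = 1 →
      0 ≤ polyOp (gjmsPoly (2 * m + 2) 0 (m + 1)) W x + (2 * m + 1).factorial)
    {p v ξ : E} (hp : ‖p‖ = 1) (hv : ‖v‖ = 1) (hpv : ⟪p, v⟫ = 0)
    (hpξ : ⟪p, ξ⟫ = 0) (hvξ : ⟪v, ξ⟫ = 0) (hξ : dirDeriv ξ W p = ‖ξ‖ ^ 2) :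
    0 ≤ (2 * m + 1) - 2 * m * dirDeriv v (dirDeriv v W) p - lap W p - 2 * m * ‖ξ‖ ^ 2 := by
  set q := gjmsPoly (2 * m + 2) 0 (m + 1)
  set c : ℝ := ((2 * m + 1).factorial : ℝ) with hc
  have hc0 : 0 < c := by rw [hc]; positivity
  set A := avg (const 1 : SphereFun E) with hA
  have : Nontrivial E := ⟨p, 0, ne_zero_of_norm_eq_one hp⟩
  have hA0 : 0 < A := avg_const_pos
  have hp0 := ne_zero_of_norm_eq_one hp
  -- The added constant makes the density non-negative. It does not affect the three limits below,
  -- since rotation derivatives and Laplacians of the kernel have average zero.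
  set f := polyOp q W + const c with hf
  set l : ℕ → ℝ := fun j => 1 + 1 / ((j : ℝ) + 1) with hldef
  have hl : ∀ j, 1 < l j := fun j => by
    have : (0 : ℝ) < 1 / ((j : ℝ) + 1) := by positivity
    simp only [hldef]
    linarith
  have hlim : Tendsto l atTop (𝓝 1) := by
    simpa [hldef] using tendsto_one_div_add_atTop_nhds_zero_nat.const_add (1 : ℝ)
  have hgreen := fun F hF => tendsto_logKernel_gjmsPoly hp hl hlim hm hn F hF
  have hrotpoly : ∀ (a b : E) (F : SphereFun E), rot a b (polyOp q F) = polyOp q (rot a b F) :=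
    fun a b => polyOp_comm (rot a b) (rot_sLap a b) q
  -- The factor of index `0` is `-X`; hence the average of `f` is that of the constant `c`.
  have hq0 : q.eval 0 = 0 := by
    simp [q, gjmsPoly_succ_left _ (Nat.succ_pos m), gjmsFactor]
  have hfavg : avg f = c * A := by
    rw [hf, map_add, avg_polyOp, hq0, avg_const]
    ring
  -- gradient term
  have L1 : Tendsto (fun j => avg (rot p ξ (logKernel hp (hl j)) * f)) atTop
      (𝓝 (-(c * ‖ξ‖ ^ 2 * A))) := by
    have h := (hgreen (rot p ξ W) (avg_rot W)).neg
    have e : rot p ξ W p = -‖ξ‖ ^ 2 := by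
      rw [rot_apply, real_inner_comm p ξ, hpξ, real_inner_self_eq_norm_sq, hp, hξ]
      ring
    rw [e] at h
    have e2 : -(-(c * -‖ξ‖ ^ 2 * A)) = -(c * ‖ξ‖ ^ 2 * A) := by ring
    rw [e2] at h
    refine h.congr fun j => ?_
    have e1 : rot p ξ (logKernel hp (hl j)) * f =
        rot p ξ (logKernel hp (hl j)) * polyOp q W + c • rot p ξ (logKernel hp (hl j)) := by
      rw [hf, ← mul_const_eq_smul]
      ext x hx
      simp only [coe_mul, coe_add]
      ring
    rw [e1, map_add, map_smul, avg_rot, avg_rot_mul, hrotpoly]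
    simp [q]
  -- Hessian term
  have L2 : Tendsto (fun j => avg (rot p v (rot p v (logKernel hp (hl j))) * f)) atTop
      (𝓝 (-(c * dirDeriv v (dirDeriv v W) p * A))) := by
    have h := hgreen (rot p v (rot p v W)) (avg_rot _)
    -- The first-order correction is the radial derivative `∂ₚW(p)`, which is zero.
    have e : rot p v (rot p v W) p = dirDeriv v (dirDeriv v W) p := by
      have hW0 := W.contDiffAt hp0
      have hd : ∀ a, DifferentiableAt ℝ (dirDeriv a W) p := fun a =>
        (contDiffAt_dirDeriv hW0 a).differentiableAt (by simp)
      have hi : ∀ a : E, DifferentiableAt ℝ (fun x => ⟪a, x⟫) p := fun a =>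
        (innerSL ℝ a).differentiableAt
      have h1 : dirDeriv v (rot p v W) p = -dirDeriv v (dirDeriv v W) p := by
        have := dirDeriv_sub (F := fun x => ⟪v, x⟫ * dirDeriv p W x)
          (G := fun x => ⟪p, x⟫ * dirDeriv v W x) ((hi v).mul (hd p)) ((hi p).mul (hd v)) v
        rw [show dirDeriv v (rot p v W) p = _ from this, dirDeriv_mul (hi v) (hd p),
          dirDeriv_mul (hi p) (hd v), dirDeriv_inner, dirDeriv_inner, real_inner_comm p v, hpv,
          real_inner_self_eq_norm_sq, real_inner_self_eq_norm_sq, hp, hv, W.dirDeriv_self hp0]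
        ring
      rw [rot_apply, h1, real_inner_comm p v, hpv, real_inner_self_eq_norm_sq, hp]
      ring
    rw [e] at h
    refine h.congr fun j => ?_
    have e1 : rot p v (rot p v (logKernel hp (hl j))) * f =
        rot p v (rot p v (logKernel hp (hl j))) * polyOp q W +
          c • rot p v (rot p v (logKernel hp (hl j))) := by
      rw [hf, ← mul_const_eq_smul]
      ext x hx
      simp only [coe_mul, coe_add]
      ring
    rw [e1, map_add, map_smul, avg_rot, avg_rot_mul, avg_rot_mul, hrotpoly, hrotpoly]
    simp [q]
  -- Laplacian term
  have L3 : Tendsto (fun j => avg (sLap (logKernel hp (hl j)) * f)) atTop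
      (𝓝 (-(c * lap W p * A))) := by
    have h := hgreen (sLap W) (avg_sLap W)
    rw [sLap_apply, hp, one_pow, one_mul] at h
    refine h.congr fun j => ?_
    have e1 : sLap (logKernel hp (hl j)) * f =
        sLap (logKernel hp (hl j)) * polyOp q W + c • sLap (logKernel hp (hl j)) := by
      rw [hf, ← mul_const_eq_smul]
      ext x hx
      simp only [coe_mul, coe_add]
      ring
    rw [e1, map_add, map_smul, avg_sLap, avg_sLap_mul, polyOp_comm sLap (fun _ => rfl)]
    simp [q]
  have hm0 : (0 : ℝ) ≤ 2 * m := by positivity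
  -- The weight `2 * (2 * m)` is the linear term `-2 ∂_ξ W` multiplied by `n - 2`; the matching `+2m
  -- ‖ξ‖²` is in the constant.
  have Lsum := (((L2.const_mul (2 * m : ℝ)).add L3).add (L1.const_mul (2 * (2 * m) : ℝ))).add_const
    ((2 * m + 1 + 2 * m * ‖ξ‖ ^ 2) * (c * A))
  have hnn := ge_of_tendsto' Lsum fun j => (show 0 ≤ _ by
    -- Turning the constant back into an average of `f` puts everything under a single average.
    rw [← hfavg]
    simp only [← smul_eq_mul, ← map_smul, ← map_add]
    refine avg_nonneg fun x hx => ?_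
    have hx0 := ne_zero_of_norm_eq_one hx
    have hfx : 0 ≤ f x := by
      rw [hf, coe_add, const_apply _ hx0]
      exact hW x hx
    have hk := kernel_pointwise_nonneg hp hv hpv hpξ hvξ hx (hl j) hm0
    rw [rot_rot_logKernel hp (hl j) hv hpv, rot_logKernel hp (hl j) hpξ, sLap_logKernel hp (hl j) hn]
    simp only [coe_add, coe_smul, coe_mul, coe_sub, coe_neg, const_apply _ hx0,
      invKernel_apply hp _ _ hx0, coord_apply, hx, inv_one, mul_one, pow_one, smul_eq_mul]
    push_cast
    refine (mul_nonneg hk hfx).trans_eq ?_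
    ring)
  have : 0 ≤ c * A * ((2 * m + 1) - 2 * m * dirDeriv v (dirDeriv v W) p - lap W p -
      2 * m * ‖ξ‖ ^ 2) := by
    refine hnn.trans_eq ?_
    ring
  exact nonneg_of_mul_nonneg_right this (mul_pos hc0 hA0)

end SphereFun

end PolyOp

/-! ### Conformally flat metrics in coordinates -/

section ConformallyFlat

variable {n : ℕ}

lemma pderiv_eq_dirDeriv (i : Fin n) :
    pderiv i = dirDeriv (EuclideanSpace.single i (1 : ℝ)) := rfl

/-- The Kronecker delta. -/
def kronecker (i j : Fin n) : ℝ := if i = j then 1 else 0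

lemma kronecker_self (i : Fin n) : kronecker i i = 1 := if_pos rfl

lemma kronecker_comm (i j : Fin n) : kronecker i j = kronecker j i := by
  simp only [kronecker, eq_comm]

lemma sum_kronecker_mul (i : Fin n) (f : Fin n → ℝ) : ∑ k, kronecker i k * f k = f i := by
  simp [kronecker]

lemma sum_kronecker_mul' (i : Fin n) (f : Fin n → ℝ) : ∑ k, kronecker k i * f k = f i := by
  simp [kronecker]

/-- The matrix of components of the metric `e^{2φ} δ`. -/
def flatConformal (φ : EuclideanSpace ℝ (Fin n) → ℝ) (y : EuclideanSpace ℝ (Fin n)) :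
    Matrix (Fin n) (Fin n) ℝ :=
  fun i j => Real.exp (2 * φ y) * kronecker i j

variable {φ : EuclideanSpace ℝ (Fin n) → ℝ}

lemma flatConformal_inv (φ : EuclideanSpace ℝ (Fin n) → ℝ) (y : EuclideanSpace ℝ (Fin n))
    (i j : Fin n) : (flatConformal φ y)⁻¹ i j = Real.exp (-(2 * φ y)) * kronecker i j := by
  have h : ∀ c : ℝ, (fun i j : Fin n => c * kronecker i j : Matrix (Fin n) (Fin n) ℝ) =
      c • (1 : Matrix (Fin n) (Fin n) ℝ) := by
    intro c
    ext i j
    simp [kronecker, Matrix.one_apply]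
  have h2 : (flatConformal φ y)⁻¹ =
      (fun i j : Fin n => Real.exp (-(2 * φ y)) * kronecker i j : Matrix (Fin n) (Fin n) ℝ) := by
    refine Matrix.inv_eq_right_inv ?_
    rw [h, show flatConformal φ y = Real.exp (2 * φ y) • (1 : Matrix (Fin n) (Fin n) ℝ) from h _]
    rw [smul_mul_smul_comm, ← Real.exp_add]
    simp
  rw [h2]

lemma pderiv_flatConformal (hφ : ContDiff ℝ ∞ φ) (i j k : Fin n) (y : EuclideanSpace ℝ (Fin n)) :
    pderiv k (fun z => flatConformal φ z i j) y =
      2 * Real.exp (2 * φ y) * pderiv k φ y * kronecker i j := by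
  have h1 : (fun z => flatConformal φ z i j) =
      fun z => kronecker i j * (fun t => Real.exp (2 * t)) (φ z) := by
    ext z
    simp only [flatConformal]
    ring
  have h2 : HasDerivAt (fun t : ℝ => Real.exp (2 * t)) (Real.exp (2 * φ y) * 2) (φ y) := by
    simpa using ((hasDerivAt_id (φ y)).const_mul 2).exp
  rw [pderiv_eq_dirDeriv, h1, dirDeriv_const_mul,
    dirDeriv_comp_of_hasDerivAt h2 (hφ.differentiable (by simp)).differentiableAt]
  ring

lemma christoffel_flatConformal (hφ : ContDiff ℝ ∞ φ) (k i j : Fin n)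
    (y : EuclideanSpace ℝ (Fin n)) :
    christoffel (flatConformal φ) k i j y = kronecker k j * pderiv i φ y +
      kronecker k i * pderiv j φ y - kronecker i j * pderiv k φ y := by
  simp only [christoffel, flatConformal_inv, pderiv_flatConformal hφ]
  have h : ∀ l, Real.exp (-(2 * φ y)) * kronecker k l *
      (2 * Real.exp (2 * φ y) * pderiv i φ y * kronecker j l +
        2 * Real.exp (2 * φ y) * pderiv j φ y * kronecker i l -
        2 * Real.exp (2 * φ y) * pderiv l φ y * kronecker i j) =
      kronecker k l * (2 * (kronecker j l * pderiv i φ y + kronecker i l * pderiv j φ y -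
        kronecker i j * pderiv l φ y)) := by
    intro l
    rw [Real.exp_neg]
    field_simp
  simp only [h, sum_kronecker_mul]
  rw [kronecker_comm j k, kronecker_comm i k]
  ring

lemma pderiv_christoffel_flatConformal (hφ : ContDiff ℝ ∞ φ) (l k i j : Fin n)
    (y : EuclideanSpace ℝ (Fin n)) :
    pderiv l (christoffel (flatConformal φ) k i j) y = kronecker k j * pderiv l (pderiv i φ) y +
      kronecker k i * pderiv l (pderiv j φ) y - kronecker i j * pderiv l (pderiv k φ) y := by
  have h : christoffel (flatConformal φ) k i j = fun y => (kronecker k j * pderiv i φ y +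
      kronecker k i * pderiv j φ y) - kronecker i j * pderiv k φ y :=
    funext (christoffel_flatConformal hφ k i j)
  have hd : ∀ (c : ℝ) (i : Fin n), DifferentiableAt ℝ (fun y => c * pderiv i φ y) y := fun c i =>
    ((contDiffAt_dirDeriv hφ.contDiffAt _).differentiableAt (by simp)).const_mul c
  rw [h, pderiv_eq_dirDeriv, dirDeriv_sub
    (F := fun y => kronecker k j * pderiv i φ y + kronecker k i * pderiv j φ y)
    ((hd _ _).add (hd _ _)) (hd _ _), dirDeriv_add (hd _ _) (hd _ _), dirDeriv_const_mul,
    dirDeriv_const_mul, dirDeriv_const_mul]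

lemma kronecker_mul_self (i j : Fin n) : kronecker i j * kronecker i j = kronecker i j := by
  simp [kronecker]

/-- The classical conformal change formula over a flat background: the second-derivative and
quadratic parts are contracted separately. -/
lemma ricciCoeff_flatConformal (hφ : ContDiff ℝ ∞ φ) (i j : Fin n)
    (y : EuclideanSpace ℝ (Fin n)) :
    ricciCoeff (flatConformal φ) i j y =
      -((n : ℝ) - 2) * (pderiv i (pderiv j φ) y - pderiv i φ y * pderiv j φ y) -
        (∑ k, pderiv k (pderiv k φ) y + ((n : ℝ) - 2) * ∑ k, pderiv k φ y ^ 2) *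
          kronecker i j := by
  have hsymm : ∀ i j, pderiv i (pderiv j φ) y = pderiv j (pderiv i φ) y := fun i j =>
    dirDeriv_comm (hφ.contDiffAt.of_le two_le_infty) _ _
  simp only [ricciCoeff, christoffel_flatConformal hφ, pderiv_christoffel_flatConformal hφ]
  set a : Fin n → ℝ := fun k => pderiv k φ y with ha
  have ha' : ∀ k, pderiv k φ y = a k := fun k => rfl
  simp only [ha']
  have h1 : ∑ k, (kronecker k j * pderiv k (pderiv i φ) y + kronecker k i * pderiv k (pderiv j φ) y -
      kronecker i j * pderiv k (pderiv k φ) y - (kronecker k k * pderiv j (pderiv i φ) y +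
      kronecker k i * pderiv j (pderiv k φ) y - kronecker i k * pderiv j (pderiv k φ) y)) =
      -((n : ℝ) - 2) * pderiv i (pderiv j φ) y -
        (∑ k, pderiv k (pderiv k φ) y) * kronecker i j := by
    simp only [Finset.sum_sub_distrib, Finset.sum_add_distrib, sum_kronecker_mul',
      sum_kronecker_mul, kronecker_self, ← Finset.mul_sum, hsymm j i]
    simp
    ring
  have h2 : ∑ k, ∑ l, ((kronecker k l * a k + kronecker k k * a l - kronecker k l * a k) *
      (kronecker l j * a i + kronecker l i * a j - kronecker i j * a l) -
      (kronecker k l * a j + kronecker k j * a l - kronecker j l * a k) *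
      (kronecker l k * a i + kronecker l i * a k - kronecker i k * a l)) =
      ((n : ℝ) - 2) * (a i * a j) - ((n : ℝ) - 2) * (∑ k, a k ^ 2) * kronecker i j := by
    have e : ∀ k l, (kronecker k l * a k + kronecker k k * a l - kronecker k l * a k) *
      (kronecker l j * a i + kronecker l i * a j - kronecker i j * a l) -
      (kronecker k l * a j + kronecker k j * a l - kronecker j l * a k) *
      (kronecker l k * a i + kronecker l i * a k - kronecker i k * a l) =
      kronecker l j * (a i * a l) + kronecker l i * (a j * a l) - kronecker i j * a l ^ 2 -
      (kronecker k l * (a i * a j) + kronecker k l * (kronecker l i * (a j * a k)) -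
        kronecker k l * (kronecker i k * (a j * a l)) + kronecker k l * (kronecker k j * (a i * a l))
        + kronecker l i * (kronecker k j * (a k * a l)) - kronecker k j * (kronecker i k * a l ^ 2) -
        kronecker k l * (kronecker j l * (a i * a k)) - kronecker j l * (kronecker l i * a k ^ 2) +
        kronecker j l * (kronecker i k * (a k * a l))) := by
      intro k l
      rw [kronecker_self, kronecker_comm l k]
      linear_combination (-a i * a j) * kronecker_mul_self k l
    simp only [e, Finset.sum_sub_distrib, Finset.sum_add_distrib, sum_kronecker_mul',
      sum_kronecker_mul, ← Finset.mul_sum]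
    simp only [Finset.sum_const, Finset.card_univ, Fintype.card_fin, nsmul_eq_mul,
      kronecker_comm j i]
    ring
  rw [h1, h2]
  ring

/-- Where the metric is Euclidean to first order, the Christoffel symbols vanish. -/
lemma laplaceCoord_flatConformal (hφ : ContDiff ℝ ∞ φ) {y : EuclideanSpace ℝ (Fin n)}
    (h0 : φ y = 0) (h1 : ∀ i, pderiv i φ y = 0) (f : EuclideanSpace ℝ (Fin n) → ℝ) :
    laplaceCoord (flatConformal φ) f y = ∑ i, pderiv i (pderiv i f) y := by
  simp only [laplaceCoord, flatConformal_inv, christoffel_flatConformal hφ, h0, h1]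
  simp [sum_kronecker_mul]

end ConformallyFlat

/-! ### Stereographic charts of the sphere -/

section Chart

variable {n : ℕ}

lemma norm_coe_Sn (p : Sn n) : ‖(p : EuclideanSpace ℝ (Fin (n + 1)))‖ = 1 :=
  norm_eq_of_mem_sphere p

/-- An isometric parametrization of the hyperplane orthogonal to `p`. -/
def tangentIsometry (p : Sn n) :
    EuclideanSpace ℝ (Fin n) →ₗᵢ[ℝ] EuclideanSpace ℝ (Fin (n + 1)) :=
  haveI := Fact.mk (@finrank_euclideanSpace_fin ℝ _ (n + 1))
  ((ℝ ∙ ((-p : Sn n) : EuclideanSpace ℝ (Fin (n + 1))))ᗮ).subtypeₗᵢ.comp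
    (OrthonormalBasis.fromOrthogonalSpanSingleton n
      (ne_zero_of_mem_unit_sphere (-p))).repr.symm.toLinearIsometry

lemma inner_tangentIsometry (p : Sn n) (y : EuclideanSpace ℝ (Fin n)) :
    ⟪(p : EuclideanSpace ℝ (Fin (n + 1))), tangentIsometry p y⟫ = 0 := by
  have := Fact.mk (@finrank_euclideanSpace_fin ℝ _ (n + 1))
  have h := Submodule.mem_orthogonal_singleton_iff_inner_right.1
    ((OrthonormalBasis.fromOrthogonalSpanSingleton n
      (ne_zero_of_mem_unit_sphere (-p))).repr.symm y).2
  have h2 : ⟪-(p : EuclideanSpace ℝ (Fin (n + 1))), tangentIsometry p y⟫ = 0 := h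
  rwa [inner_neg_left, neg_eq_zero] at h2

/-- The preferred chart at `p` projects from `-p`, so `p` sits at the origin. The normalization with
`4` makes the conformal factor equal to `1` there. -/
lemma extChartAt_symm_eq (p : Sn n) (y : EuclideanSpace ℝ (Fin n)) :
    ((extChartAt (𝓡 n) p).symm y : EuclideanSpace ℝ (Fin (n + 1))) =
      (‖y‖ ^ 2 + 4)⁻¹ • ((4 : ℝ) • tangentIsometry p y +
        (4 - ‖y‖ ^ 2) • (p : EuclideanSpace ℝ (Fin (n + 1)))) := by
  have := Fact.mk (@finrank_euclideanSpace_fin ℝ _ (n + 1))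
  have h : ((extChartAt (𝓡 n) p).symm y : EuclideanSpace ℝ (Fin (n + 1))) =
      ((stereographic' n (-p)).symm y : EuclideanSpace ℝ (Fin (n + 1))) := rfl
  have h2 := stereographic'_symm_apply (n := n) (-p) y
  rw [h, h2]
  have h3 : ‖tangentIsometry p y‖ = ‖y‖ := (tangentIsometry p).norm_map y
  have h4 : ((OrthonormalBasis.fromOrthogonalSpanSingleton n
      (ne_zero_of_mem_unit_sphere (-p))).repr.symm y : EuclideanSpace ℝ (Fin (n + 1))) =
      tangentIsometry p y := rfl
  simp only [h4, h3]
  rw [show ((-p : Sn n) : EuclideanSpace ℝ (Fin (n + 1))) = -(p : EuclideanSpace ℝ (Fin (n + 1)))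
    from rfl]
  module

lemma extChartAt_target_eq_univ (p : Sn n) : (extChartAt (𝓡 n) p).target = Set.univ := by
  have := Fact.mk (@finrank_euclideanSpace_fin ℝ _ (n + 1))
  rw [extChartAt_target]
  have : (chartAt (EuclideanSpace ℝ (Fin n)) p).target = Set.univ := stereographic'_target (-p)
  simp [this]

/-- The inverse stereographic projection, up to a positive factor. -/
def projChart (p : Sn n) (y : EuclideanSpace ℝ (Fin n)) : EuclideanSpace ℝ (Fin (n + 1)) :=
  tangentIsometry p y + (1 - ‖y‖ ^ 2 / 4) • (p : EuclideanSpace ℝ (Fin (n + 1)))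

lemma extChartAt_symm_eq_smul (p : Sn n) (y : EuclideanSpace ℝ (Fin n)) :
    ((extChartAt (𝓡 n) p).symm y : EuclideanSpace ℝ (Fin (n + 1))) =
      (4 / (‖y‖ ^ 2 + 4)) • projChart p y := by
  rw [extChartAt_symm_eq, projChart]
  module

lemma projChart_zero (p : Sn n) : projChart p 0 = p := by
  simp [projChart]

lemma extChartAt_symm_zero (p : Sn n) : (extChartAt (𝓡 n) p).symm 0 = p :=
  Subtype.ext (by rw [extChartAt_symm_eq_smul, projChart_zero]; simp)

lemma extChartAt_self (p : Sn n) : extChartAt (𝓡 n) p p = 0 := by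
  conv_lhs => rw [← extChartAt_symm_zero p]
  have h := (extChartAt (𝓡 n) p).right_inv (x := 0) (by
    rw [extChartAt_target_eq_univ]; exact Set.mem_univ _)
  rwa [extChartAt_symm_zero] at h ⊢

lemma projChart_ne_zero (p : Sn n) (y : EuclideanSpace ℝ (Fin n)) : projChart p y ≠ 0 := by
  intro h
  have h2 := norm_coe_Sn ((extChartAt (𝓡 n) p).symm y)
  rw [extChartAt_symm_eq_smul, h] at h2
  simp at h2

lemma contDiff_projChart (p : Sn n) : ContDiff ℝ ∞ (projChart p) :=
  (tangentIsometry p).toContinuousLinearMap.contDiff.add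
    ((contDiff_const.sub ((contDiff_norm_sq ℝ).div_const 4)).smul contDiff_const)

lemma fderiv_projChart (p : Sn n) (y a : EuclideanSpace ℝ (Fin n)) :
    fderiv ℝ (projChart p) y a = tangentIsometry p a -
      (⟪y, a⟫ / 2) • (p : EuclideanSpace ℝ (Fin (n + 1))) := by
  have h1 : HasFDerivAt (fun y => tangentIsometry p y)
      (tangentIsometry p).toContinuousLinearMap y :=
    (tangentIsometry p).toContinuousLinearMap.hasFDerivAt
  have h2 : HasFDerivAt (fun y : EuclideanSpace ℝ (Fin n) => ‖y‖ ^ 2) (2 • innerSL ℝ y) y := by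
    simpa using (hasStrictFDerivAt_norm_sq y).hasFDerivAt
  have h3 : HasFDerivAt (fun y : EuclideanSpace ℝ (Fin n) => 1 - ‖y‖ ^ 2 / 4)
      (-((4 : ℝ)⁻¹ • (2 • innerSL ℝ y))) y := by
    have := (h2.const_mul (4 : ℝ)⁻¹).const_sub 1
    refine this.congr_of_eventuallyEq (Eventually.of_forall fun z => ?_)
    simp only
    ring
  have h4 : HasFDerivAt (projChart p) _ y :=
    h1.add (h3.smul_const (p : EuclideanSpace ℝ (Fin (n + 1))))
  rw [h4.fderiv]
  simp only [add_apply, ContinuousLinearMap.smulRight_apply,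
    neg_apply, smul_apply, innerSL_apply_apply,
    LinearIsometry.coe_toContinuousLinearMap, smul_eq_mul, nsmul_eq_mul, Nat.cast_ofNat]
  module

/-- The components of the round metric are those of a conformally flat metric. -/
lemma inner_fderiv_extChartAt_symm (p : Sn n) (y a b : EuclideanSpace ℝ (Fin n)) :
    ⟪fderiv ℝ (fun y => ((extChartAt (𝓡 n) p).symm y : EuclideanSpace ℝ (Fin (n + 1)))) y a,
      fderiv ℝ (fun y => ((extChartAt (𝓡 n) p).symm y : EuclideanSpace ℝ (Fin (n + 1)))) y b⟫ =
      (4 / (‖y‖ ^ 2 + 4)) ^ 2 * ⟪a, b⟫ := by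
  have hr : (‖y‖ ^ 2 + 4) ≠ 0 := by positivity
  have h1 : HasFDerivAt (fun y : EuclideanSpace ℝ (Fin n) => ‖y‖ ^ 2) (2 • innerSL ℝ y) y := by
    simpa using (hasStrictFDerivAt_norm_sq y).hasFDerivAt
  have h2 : HasDerivAt (fun s : ℝ => 4 / (s + 4)) (-(4 / (‖y‖ ^ 2 + 4) ^ 2)) (‖y‖ ^ 2) := by
    have := (((hasDerivAt_id (‖y‖ ^ 2)).add_const 4).inv hr).const_mul 4
    refine (this.congr_of_eventuallyEq (Eventually.of_forall fun s => ?_)).congr_deriv ?_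
    · simp [div_eq_mul_inv]
    · simp only [id]
      ring
  have h3 := h2.comp_hasFDerivAt y h1
  have h4 : HasFDerivAt (projChart p) (fderiv ℝ (projChart p) y) y :=
    ((contDiff_projChart p).differentiable (by simp)).differentiableAt.hasFDerivAt
  have h5 := h3.smul h4
  have h6 : ∀ a, fderiv ℝ (fun y => ((extChartAt (𝓡 n) p).symm y :
      EuclideanSpace ℝ (Fin (n + 1)))) y a = (4 / (‖y‖ ^ 2 + 4)) • (tangentIsometry p a -
      (⟪y, a⟫ / 2) • (p : EuclideanSpace ℝ (Fin (n + 1)))) -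
      (8 * ⟪y, a⟫ / (‖y‖ ^ 2 + 4) ^ 2) • projChart p y := by
    intro a
    have e : (fun y => ((extChartAt (𝓡 n) p).symm y : EuclideanSpace ℝ (Fin (n + 1)))) =
      ((fun s : ℝ => 4 / (s + 4)) ∘ fun y : EuclideanSpace ℝ (Fin n) => ‖y‖ ^ 2) • projChart p :=
      funext (extChartAt_symm_eq_smul p)
    rw [e, h5.fderiv]
    simp only [add_apply, ContinuousLinearMap.smulRight_apply,
      smul_apply, innerSL_apply_apply, Function.comp_apply, smul_eq_mul,
      nsmul_eq_mul, Nat.cast_ofNat, fderiv_projChart]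
    module
  have hU : ∀ a b, ⟪tangentIsometry p a, tangentIsometry p b⟫ = ⟪a, b⟫ :=
    (tangentIsometry p).inner_map_map
  have hpU := inner_tangentIsometry p
  have hUp : ∀ a, ⟪tangentIsometry p a, (p : EuclideanSpace ℝ (Fin (n + 1)))⟫ = 0 := fun a => by
    rw [real_inner_comm, hpU]
  rw [h6, h6, projChart]
  simp only [inner_sub_left, inner_sub_right, inner_add_left, inner_add_right, inner_smul_left,
    inner_smul_right, hU, hpU, hUp, real_inner_self_eq_norm_sq, norm_coe_Sn, RCLike.conj_to_real,
    real_inner_comm y a]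
  field_simp
  ring

/-- The logarithm of the conformal factor of the round metric in a stereographic chart. -/
def roundFactor (y : EuclideanSpace ℝ (Fin n)) : ℝ := Real.log (4 / (‖y‖ ^ 2 + 4))

lemma roundFactor_eq (y : EuclideanSpace ℝ (Fin n)) :
    roundFactor y = Real.log 4 - Real.log (‖y‖ ^ 2 + 4) :=
  Real.log_div (by norm_num) (by positivity)

lemma contDiff_roundFactor : ContDiff ℝ ∞ (roundFactor (n := n)) := by
  have h : (roundFactor (n := n)) = fun y => Real.log 4 - Real.log (‖y‖ ^ 2 + 4) :=
    funext roundFactor_eq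
  rw [h]
  exact contDiff_const.sub (((contDiff_norm_sq ℝ).add contDiff_const).log fun y => by positivity)

lemma dirDeriv_roundFactor (y a : EuclideanSpace ℝ (Fin n)) :
    dirDeriv a roundFactor y = ⟪a, y⟫ * (-2 * (‖y‖ ^ 2 + 4)⁻¹) := by
  have h : ∀ s : ℝ, 0 ≤ s → HasDerivAt (fun s : ℝ => Real.log 4 - Real.log (s + 4)) (-(s + 4)⁻¹) s :=
    fun s hs => by
      have h0 : s + 4 ≠ 0 := by positivity
      have := (((hasDerivAt_id s).add_const 4).log h0).const_sub (Real.log 4)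
      exact this.congr_deriv (by simp [div_eq_mul_inv])
  have hN : DifferentiableAt ℝ (fun y : EuclideanSpace ℝ (Fin n) => ‖y‖ ^ 2) y :=
    (contDiff_norm_sq ℝ (n := 1)).contDiffAt.differentiableAt one_ne_zero
  rw [show (roundFactor (n := n)) = fun y => (fun s : ℝ => Real.log 4 - Real.log (s + 4)) (‖y‖ ^ 2)
    from funext roundFactor_eq, dirDeriv_comp_of_hasDerivAt (F := fun y => ‖y‖ ^ 2)
    (φ := fun s : ℝ => Real.log 4 - Real.log (s + 4)) (h _ (by positivity)) hN,
    dirDeriv, fderiv_norm_sq_apply, real_inner_comm y a]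
  simp
  ring

/-- Source of the round Ricci term: this Hessian contributes `(n - 2)/2 + n/2 = n - 1` in the
conformal change formula. -/
lemma dirDeriv_dirDeriv_roundFactor (a b : EuclideanSpace ℝ (Fin n)) :
    dirDeriv a (dirDeriv b roundFactor) 0 = -(⟪b, a⟫ / 2) := by
  have hd : DifferentiableAt ℝ (fun y : EuclideanSpace ℝ (Fin n) => -2 * (‖y‖ ^ 2 + 4)⁻¹) 0 :=
    ((((contDiff_norm_sq ℝ (n := 1)).contDiffAt.differentiableAt one_ne_zero).add_const 4).inv
      (by norm_num)).const_mul _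
  rw [show dirDeriv b roundFactor = fun y : EuclideanSpace ℝ (Fin n) =>
    ⟪b, y⟫ * (-2 * (‖y‖ ^ 2 + 4)⁻¹) from funext fun y => dirDeriv_roundFactor y b,
    dirDeriv_mul (F := fun y => ⟪b, y⟫) (innerSL ℝ b).differentiableAt hd, dirDeriv_inner]
  simp
  ring

lemma inclDeriv_comp_mfderiv (p : Sn n) (y a : EuclideanSpace ℝ (Fin n)) :
    inclDeriv n ((extChartAt (𝓡 n) p).symm y)
      (mfderiv 𝓘(ℝ, EuclideanSpace ℝ (Fin n)) (𝓡 n) (extChartAt (𝓡 n) p).symm y a) =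
    fderiv ℝ (fun y => ((extChartAt (𝓡 n) p).symm y : EuclideanSpace ℝ (Fin (n + 1)))) y a := by
  have := Fact.mk (@finrank_euclideanSpace_fin ℝ _ (n + 1))
  have h1 : MDifferentiableAt (𝓡 n) 𝓘(ℝ, EuclideanSpace ℝ (Fin (n + 1)))
      (fun q : Sn n => (q : EuclideanSpace ℝ (Fin (n + 1)))) ((extChartAt (𝓡 n) p).symm y) :=
    (contMDiff_coe_sphere (m := 1)).contMDiffAt.mdifferentiableAt one_ne_zero
  have h2 : MDifferentiableAt 𝓘(ℝ, EuclideanSpace ℝ (Fin n)) (𝓡 n) (extChartAt (𝓡 n) p).symm y := by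
    have := contMDiffOn_extChartAt_symm (I := 𝓡 n) (n := 1) p
    rw [extChartAt_target_eq_univ] at this
    exact (this.contMDiffAt univ_mem).mdifferentiableAt one_ne_zero
  have h3 := mfderiv_comp y h1 h2
  rw [mfderiv_eq_fderiv] at h3
  have h4 := congrArg (fun T : EuclideanSpace ℝ (Fin n) →L[ℝ] EuclideanSpace ℝ (Fin (n + 1)) => T a) h3
  exact h4.symm

lemma metricCoeff_roundMetric (p : Sn n) (y : EuclideanSpace ℝ (Fin n)) :
    metricCoeff (roundMetric n) p y = flatConformal roundFactor y := by
  ext i j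
  have h : metricCoeff (roundMetric n) p y i j =
    ⟪fderiv ℝ (fun y => ((extChartAt (𝓡 n) p).symm y : EuclideanSpace ℝ (Fin (n + 1)))) y
      (EuclideanSpace.single i 1),
      fderiv ℝ (fun y => ((extChartAt (𝓡 n) p).symm y : EuclideanSpace ℝ (Fin (n + 1)))) y
      (EuclideanSpace.single j 1)⟫ := by
    rw [← inclDeriv_comp_mfderiv, ← inclDeriv_comp_mfderiv]
    rfl
  rw [h, inner_fderiv_extChartAt_symm, flatConformal, two_mul, Real.exp_add, roundFactor,
    Real.exp_log (by positivity), ← pow_two]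
  congr 1
  simp [kronecker, EuclideanSpace.inner_single_left]

lemma metricCoeff_conformalMetric (w : Sn n → ℝ) (p : Sn n) :
    metricCoeff (conformalMetric w (roundMetric n)) p =
      flatConformal fun y => w ((extChartAt (𝓡 n) p).symm y) + roundFactor y := by
  ext y i j
  have h : metricCoeff (conformalMetric w (roundMetric n)) p y i j =
    Real.exp (2 * w ((extChartAt (𝓡 n) p).symm y)) * metricCoeff (roundMetric n) p y i j := rfl
  rw [h, metricCoeff_roundMetric]
  simp only [flatConformal]
  rw [mul_add, Real.exp_add]
  ring

end Chart

/-! ### Functions on the sphere in stereographic charts -/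

section Extension

variable {n : ℕ}

open SphereFun

lemma SphereFun.apply_extChartAt_symm (F : SphereFun (EuclideanSpace ℝ (Fin (n + 1)))) (p : Sn n)
    (y : EuclideanSpace ℝ (Fin n)) :
    F ((extChartAt (𝓡 n) p).symm y : EuclideanSpace ℝ (Fin (n + 1))) = F (projChart p y) := by
  rw [extChartAt_symm_eq_smul, F.smul_apply_pos (by positivity)]

lemma SphereFun.contDiff_comp_projChart (F : SphereFun (EuclideanSpace ℝ (Fin (n + 1)))) (p : Sn n) :
    ContDiff ℝ ∞ fun y => F (projChart p y) :=
  contDiff_iff_contDiffAt.2 fun y =>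
    (F.contDiffAt (projChart_ne_zero p y)).comp y (contDiff_projChart p).contDiffAt

lemma dirDeriv_comp_projChart {G : EuclideanSpace ℝ (Fin (n + 1)) → ℝ} (p : Sn n)
    {y : EuclideanSpace ℝ (Fin n)} (hG : DifferentiableAt ℝ G (projChart p y))
    (a : EuclideanSpace ℝ (Fin n)) :
    dirDeriv a (fun y => G (projChart p y)) y =
      dirDeriv (tangentIsometry p a) G (projChart p y) -
        ⟪a, y⟫ * (dirDeriv (p : EuclideanSpace ℝ (Fin (n + 1))) G (projChart p y) / 2) := by
  have h1 : HasFDerivAt (projChart p) (fderiv ℝ (projChart p) y) y :=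
    ((contDiff_projChart p).differentiable (by simp)).differentiableAt.hasFDerivAt
  have h2 := (hG.hasFDerivAt.comp y h1).fderiv
  rw [dirDeriv, show (fun y => G (projChart p y)) = G ∘ projChart p from rfl, h2,
    ContinuousLinearMap.comp_apply, fderiv_projChart, map_sub, map_smul, dirDeriv, dirDeriv,
    real_inner_comm y a, smul_eq_mul]
  ring

lemma SphereFun.dirDeriv_comp_projChart_zero (F : SphereFun (EuclideanSpace ℝ (Fin (n + 1))))
    (p : Sn n) (a : EuclideanSpace ℝ (Fin n)) :
    dirDeriv a (fun y => F (projChart p y)) 0 = dirDeriv (tangentIsometry p a) F p := by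
  rw [dirDeriv_comp_projChart p (F.differentiableAt (projChart_ne_zero p 0)), projChart_zero,
    inner_zero_right, zero_mul, sub_zero]

/-- The second derivative of `projChart` at the origin points along `p`, where `F` has zero
derivative by Euler's identity. -/
lemma SphereFun.dirDeriv_dirDeriv_comp_projChart (F : SphereFun (EuclideanSpace ℝ (Fin (n + 1))))
    (p : Sn n) (a b : EuclideanSpace ℝ (Fin n)) :
    dirDeriv a (dirDeriv b fun y => F (projChart p y)) 0 =
      dirDeriv (tangentIsometry p a) (dirDeriv (tangentIsometry p b) F) p := by
  have hd : ∀ c, DifferentiableAt ℝ (dirDeriv c F) (projChart p 0) := fun c =>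
    (contDiffAt_dirDeriv (F.contDiffAt (projChart_ne_zero p 0)) c).differentiableAt (by simp)
  have hp : DifferentiableAt ℝ (projChart p) 0 :=
    (contDiff_projChart p).contDiffAt.differentiableAt (by simp)
  have hp2 : DifferentiableAt ℝ
      (fun y => dirDeriv (p : EuclideanSpace ℝ (Fin (n + 1))) F (projChart p y) / 2) 0 := by
    simp only [div_eq_mul_inv]
    exact ((hd _).comp 0 hp).mul_const _
  have hb : DifferentiableAt ℝ (fun y => ⟪b, y⟫) (0 : EuclideanSpace ℝ (Fin n)) :=
    (innerSL ℝ b).differentiableAt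
  rw [show (dirDeriv b fun y => F (projChart p y)) = fun y =>
      (fun y => dirDeriv (tangentIsometry p b) F (projChart p y)) y - (fun y => ⟪b, y⟫ *
        (dirDeriv (p : EuclideanSpace ℝ (Fin (n + 1))) F (projChart p y) / 2)) y from
    funext fun y => dirDeriv_comp_projChart p (F.differentiableAt (projChart_ne_zero p y)) b,
    dirDeriv_sub (F := fun y => dirDeriv (tangentIsometry p b) F (projChart p y))
      (G := fun y => ⟪b, y⟫ * (dirDeriv (p : EuclideanSpace ℝ (Fin (n + 1))) F (projChart p y) / 2))
      ((hd _).comp 0 hp) (hb.mul hp2),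
    dirDeriv_mul (F := fun y => ⟪b, y⟫)
      (G := fun y => dirDeriv (p : EuclideanSpace ℝ (Fin (n + 1))) F (projChart p y) / 2)
      hb hp2, dirDeriv_comp_projChart p (hd _), projChart_zero,
    F.dirDeriv_self (ne_zero_of_norm_eq_one (norm_coe_Sn p))]
  simp

/-- The derivative `∂ₚF` is homogeneous of degree `-1` and vanishes at `p`, hence along the whole
ray. -/
lemma SphereFun.dirDeriv_dirDeriv_self (F : SphereFun (EuclideanSpace ℝ (Fin (n + 1))))
    {p : EuclideanSpace ℝ (Fin (n + 1))} (hp : p ≠ 0) : dirDeriv p (dirDeriv p F) p = 0 := by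
  have hd : DifferentiableAt ℝ (dirDeriv p F) p :=
    (contDiffAt_dirDeriv (F.contDiffAt hp) p).differentiableAt (by simp)
  have h1 : HasDerivAt (fun r : ℝ => dirDeriv p F (r • p))
      (fderiv ℝ (dirDeriv p F) ((1 : ℝ) • p) ((1 : ℝ) • p)) 1 := by
    have h2 : HasFDerivAt (dirDeriv p F) (fderiv ℝ (dirDeriv p F) ((1 : ℝ) • p)) ((1 : ℝ) • p) := by
      rw [one_smul]; exact hd.hasFDerivAt
    exact h2.comp_hasDerivAt (1 : ℝ) ((hasDerivAt_id (1 : ℝ)).smul_const p)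
  have h3 : (fun r : ℝ => dirDeriv p F (r • p)) =ᶠ[𝓝 1] fun _ => 0 := by
    filter_upwards [lt_mem_nhds (zero_lt_one (α := ℝ))] with r hr
    rw [dirDeriv_homogeneous (c := 1) hr (fun x => by rw [F.smul_apply_pos hr, one_mul]),
      F.dirDeriv_self hp, mul_zero]
  have := h1.unique ((hasDerivAt_const (1 : ℝ) (0 : ℝ)).congr_of_eventuallyEq h3)
  simpa [dirDeriv] using this

lemma exists_orthonormalBasis_tangent (p : Sn n) :
    ∃ b : OrthonormalBasis (Option (Fin n)) ℝ (EuclideanSpace ℝ (Fin (n + 1))),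
      b none = p ∧ ∀ i, b (some i) = tangentIsometry p (EuclideanSpace.single i 1) := by
  set v : Option (Fin n) → EuclideanSpace ℝ (Fin (n + 1)) := fun o =>
    o.elim p fun i => tangentIsometry p (EuclideanSpace.single i 1) with hv
  have ho : Orthonormal ℝ v := by
    rw [orthonormal_iff_ite]
    rintro (_ | i) (_ | j)
    · simp [hv]
    · simp [hv, inner_tangentIsometry]
    · rw [real_inner_comm]
      simp [hv, inner_tangentIsometry]
    · simp [hv, (tangentIsometry p).inner_map_map, EuclideanSpace.inner_single_left]
  obtain ⟨b, hb⟩ := Orthonormal.exists_orthonormalBasis_extension_of_card_eq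
    (ι := Option (Fin n)) (v := v) (s := Set.univ) (by simp)
    (ho.comp _ Subtype.val_injective)
  exact ⟨b, hb none trivial, fun i => hb (some i) trivial⟩

lemma SphereFun.lap_eq_sum_tangent (F : SphereFun (EuclideanSpace ℝ (Fin (n + 1)))) (p : Sn n) :
    lap F p = ∑ i, dirDeriv (tangentIsometry p (EuclideanSpace.single i 1))
      (dirDeriv (tangentIsometry p (EuclideanSpace.single i 1)) F)
        (p : EuclideanSpace ℝ (Fin (n + 1))) := by
  have hp := ne_zero_of_norm_eq_one (norm_coe_Sn p)
  obtain ⟨b, hb1, hb2⟩ := exists_orthonormalBasis_tangent p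
  rw [lap_eq_sum b ((F.contDiffAt hp).of_le two_le_infty), Fintype.sum_option, hb1,
    F.dirDeriv_dirDeriv_self hp, zero_add]
  simp only [hb2]

/-- At the centre of the chart the metric is Euclidean to first order, and the ambient Laplacian has
no radial contribution, so both sides are the tangential trace. -/
lemma laplaceBeltrami_roundMetric {f : Sn n → ℝ} {F : SphereFun (EuclideanSpace ℝ (Fin (n + 1)))}
    (h : ∀ q : Sn n, f q = F q) (p : Sn n) : laplaceBeltrami (roundMetric n) f p = sLap F p := by
  have h0 : roundFactor (0 : EuclideanSpace ℝ (Fin n)) = 0 := by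
    simp [roundFactor]
  have h1 : ∀ i : Fin n, pderiv i roundFactor (0 : EuclideanSpace ℝ (Fin n)) = 0 := fun i => by
    rw [pderiv_eq_dirDeriv, dirDeriv_roundFactor, inner_zero_right, zero_mul]
  have e1 : metricCoeff (roundMetric n) p = flatConformal roundFactor :=
    funext (metricCoeff_roundMetric p)
  rw [laplaceBeltrami, extChartAt_self, e1, laplaceCoord_flatConformal contDiff_roundFactor h0 h1,
    sLap_apply, norm_coe_Sn, one_pow, one_mul, F.lap_eq_sum_tangent p]
  refine Finset.sum_congr rfl fun i _ => ?_
  rw [show (fun y => f ((extChartAt (𝓡 n) p).symm y)) = fun y => F (projChart p y) from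
    funext fun y => by rw [h, F.apply_extChartAt_symm], pderiv_eq_dirDeriv,
    F.dirDeriv_dirDeriv_comp_projChart]

lemma gjmsProd_eq_polyOp {w : Sn n → ℝ} {W : SphereFun (EuclideanSpace ℝ (Fin (n + 1)))}
    (h : ∀ q : Sn n, w q = W q) (k : ℕ) (p : Sn n) :
    gjmsProd n k w p = polyOp (gjmsPoly n 0 k) W p := by
  induction k generalizing p with
  | zero =>
    have : gjmsPoly n 0 0 = 1 := by simp [gjmsPoly]
    rw [gjmsProd, this, polyOp_one, h]
  | succ k ih =>
    rw [gjmsPoly_succ_right, polyOp_mul, polyOp_gjmsFactor]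
    simp only [gjmsProd]
    rw [laplaceBeltrami_roundMetric ih, ih]
    rfl

/-- A smooth function on the sphere extends to a function that is constant along rays. -/
lemma exists_sphereFun {w : Sn n → ℝ} (hw : ContMDiff (𝓡 n) 𝓘(ℝ, ℝ) ∞ w) :
    ∃ W : SphereFun (EuclideanSpace ℝ (Fin (n + 1))), ∀ q : Sn n, w q = W q := by
  classical
  have := Fact.mk (@finrank_euclideanSpace_fin ℝ _ (n + 1))
  have hmem : ∀ x : EuclideanSpace ℝ (Fin (n + 1)), x ≠ 0 →
      ‖x‖⁻¹ • x ∈ Metric.sphere (0 : EuclideanSpace ℝ (Fin (n + 1))) 1 := fun x hx => by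
    rw [mem_sphere_zero_iff_norm, norm_smul, norm_inv, norm_norm,
      inv_mul_cancel₀ (norm_ne_zero_iff.2 hx)]
  set W : EuclideanSpace ℝ (Fin (n + 1)) → ℝ := fun x =>
    if hx : x ≠ 0 then w ⟨‖x‖⁻¹ • x, hmem x hx⟩ else 0 with hW
  have hWx : ∀ (x : EuclideanSpace ℝ (Fin (n + 1))) (hx : x ≠ 0),
      W x = w ⟨‖x‖⁻¹ • x, hmem x hx⟩ := fun x hx => dif_pos hx
  let Ω : TopologicalSpace.Opens (EuclideanSpace ℝ (Fin (n + 1))) := ⟨{0}ᶜ, isOpen_ne_zero⟩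
  refine ⟨⟨W, fun x hx => ContDiffAt.contDiffWithinAt ?_, fun r hr x => ?_, by simp [hW]⟩,
    fun q => ?_⟩
  -- On the open set `Ω` the extension is `w` composed with the smooth normalization map into the
  -- sphere.
  · have h1 : ContMDiff 𝓘(ℝ, EuclideanSpace ℝ (Fin (n + 1)))
        𝓘(ℝ, EuclideanSpace ℝ (Fin (n + 1))) ∞
        (fun x : Ω => ‖(x : EuclideanSpace ℝ (Fin (n + 1)))‖⁻¹ •
          (x : EuclideanSpace ℝ (Fin (n + 1)))) := fun x =>
      (contMDiffAt_subtype_iff (U := Ω)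
        (f := fun x : EuclideanSpace ℝ (Fin (n + 1)) => ‖x‖⁻¹ • x)).2
        (((contDiffAt_inv_norm x.2).smul contDiffAt_id).contMDiffAt)
    have h2 := hw.comp (h1.codRestrict_sphere (n := n) fun x => hmem x x.2)
    have h3 := (contMDiffAt_subtype_iff (U := Ω) (f := W) (x := ⟨x, hx⟩)
      (I := 𝓘(ℝ, EuclideanSpace ℝ (Fin (n + 1)))) (I' := 𝓘(ℝ, ℝ)) (n := ∞)).1
      ((h2 ⟨x, hx⟩).congr_of_eventuallyEq (Eventually.of_forall fun y => hWx y y.2))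
    exact h3.contDiffAt
  · rcases eq_or_ne x 0 with rfl | hx
    · simp
    · rw [hWx x hx, hWx (r • x) (smul_ne_zero hr.ne' hx)]
      congr 2
      have := norm_ne_zero_iff.2 hx
      rw [norm_smul, Real.norm_eq_abs, abs_of_pos hr, smul_smul]
      congr 1
      field_simp
  · refine Eq.trans ?_ (hWx q (ne_zero_of_norm_eq_one (norm_coe_Sn q))).symm
    congr 1
    exact Subtype.ext (by simp)

/-! ### The Ricci tensor of a conformal metric on the sphere -/

lemma ricciCoeff_conformalMetric {w : Sn n → ℝ}
    {W : SphereFun (EuclideanSpace ℝ (Fin (n + 1)))} (h : ∀ q : Sn n, w q = W q) (p : Sn n)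
    (i j : Fin n) :
    ricciCoeff (metricCoeff (conformalMetric w (roundMetric n)) p) i j 0 =
      -((n : ℝ) - 2) * (dirDeriv (tangentIsometry p (EuclideanSpace.single i 1))
        (dirDeriv (tangentIsometry p (EuclideanSpace.single j 1)) W) p -
        dirDeriv (tangentIsometry p (EuclideanSpace.single i 1)) W p *
        dirDeriv (tangentIsometry p (EuclideanSpace.single j 1)) W p) -
      (lap W p + ((n : ℝ) - 2) *
        ∑ k, dirDeriv (tangentIsometry p (EuclideanSpace.single k 1)) W p ^ 2 - ((n : ℝ) - 1)) *
          kronecker i j := by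
  have e : (fun y => w ((extChartAt (𝓡 n) p).symm y) + roundFactor y) =
      fun y => W (projChart p y) + roundFactor y :=
    funext fun y => by rw [h, W.apply_extChartAt_symm]
  have hW := W.contDiff_comp_projChart p
  have hR := contDiff_roundFactor (n := n)
  have e1 : ∀ a : EuclideanSpace ℝ (Fin n),
      dirDeriv a (fun y => W (projChart p y) + roundFactor y) = fun y =>
        dirDeriv a (fun y => W (projChart p y)) y + dirDeriv a roundFactor y := fun a =>
    funext fun y => dirDeriv_add (hW.differentiable (by simp)).differentiableAt
      (hR.differentiable (by simp)).differentiableAt a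
  have e2 : ∀ a b : EuclideanSpace ℝ (Fin n),
      dirDeriv a (dirDeriv b fun y => W (projChart p y) + roundFactor y) 0 =
        dirDeriv (tangentIsometry p a) (dirDeriv (tangentIsometry p b) W) p - ⟪b, a⟫ / 2 := by
    intro a b
    rw [e1, dirDeriv_add ((contDiffAt_dirDeriv hW.contDiffAt b).differentiableAt (by simp))
      ((contDiffAt_dirDeriv hR.contDiffAt b).differentiableAt (by simp)),
      W.dirDeriv_dirDeriv_comp_projChart, dirDeriv_dirDeriv_roundFactor]
    ring
  have e3 : ∀ a : EuclideanSpace ℝ (Fin n),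
      dirDeriv a (fun y => W (projChart p y) + roundFactor y) 0 =
        dirDeriv (tangentIsometry p a) W p := fun a => by
    simp only [e1]
    rw [W.dirDeriv_comp_projChart_zero, dirDeriv_roundFactor, inner_zero_right, zero_mul,
      add_zero]
  rw [metricCoeff_conformalMetric, e, ricciCoeff_flatConformal (hW.add hR)]
  simp only [pderiv_eq_dirDeriv, e2, e3, Finset.sum_sub_distrib, ← W.lap_eq_sum_tangent p]
  have hk : ∀ i j : Fin n, ⟪EuclideanSpace.single j (1 : ℝ), EuclideanSpace.single i (1 : ℝ)⟫ =
      kronecker i j := fun i j => by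
    simp [kronecker, EuclideanSpace.inner_single_left, eq_comm]
  simp only [hk, kronecker_self]
  simp
  ring

lemma dirDeriv_tangentIsometry_eq_sum (p : Sn n) (F : EuclideanSpace ℝ (Fin (n + 1)) → ℝ)
    (V : EuclideanSpace ℝ (Fin n)) (x : EuclideanSpace ℝ (Fin (n + 1))) :
    dirDeriv (tangentIsometry p V) F x =
      ∑ i, V i * dirDeriv (tangentIsometry p (EuclideanSpace.single i 1)) F x := by
  conv_lhs => rw [← (EuclideanSpace.basisFun (Fin n) ℝ).sum_repr V]
  simp [dirDeriv]

lemma dirDeriv_dirDeriv_tangentIsometry_eq_sum (p : Sn n)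
    {F : EuclideanSpace ℝ (Fin (n + 1)) → ℝ} {x : EuclideanSpace ℝ (Fin (n + 1))}
    (hF : ContDiffAt ℝ 2 F x) (V : EuclideanSpace ℝ (Fin n)) :
    dirDeriv (tangentIsometry p V) (dirDeriv (tangentIsometry p V) F) x =
      ∑ i, ∑ j, dirDeriv (tangentIsometry p (EuclideanSpace.single i 1))
        (dirDeriv (tangentIsometry p (EuclideanSpace.single j 1)) F) x * V i * V j := by
  rw [dirDeriv_tangentIsometry_eq_sum]
  refine Finset.sum_congr rfl fun i _ => ?_
  rw [dirDeriv_comm hF, dirDeriv_tangentIsometry_eq_sum, Finset.mul_sum]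
  refine Finset.sum_congr rfl fun j _ => ?_
  rw [dirDeriv_comm hF]
  ring

lemma sum_kronecker_mul_mul (V : EuclideanSpace ℝ (Fin n)) :
    ∑ i, ∑ j, kronecker i j * V i * V j = ‖V‖ ^ 2 := by
  rw [EuclideanSpace.real_norm_sq_eq]
  refine Finset.sum_congr rfl fun i _ => ?_
  simp only [mul_assoc, sum_kronecker_mul]
  ring

/-- The Ricci curvature of `e^{2w} g₀` in the direction of a vector with components `V`. -/
lemma sum_ricciCoeff_conformalMetric {w : Sn n → ℝ}
    {W : SphereFun (EuclideanSpace ℝ (Fin (n + 1)))} (h : ∀ q : Sn n, w q = W q) (p : Sn n)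
    (V : EuclideanSpace ℝ (Fin n)) :
    ∑ i, ∑ j, ricciCoeff (metricCoeff (conformalMetric w (roundMetric n)) p) i j 0 * V i * V j =
      -((n : ℝ) - 2) * (dirDeriv (tangentIsometry p V) (dirDeriv (tangentIsometry p V) W) p -
        dirDeriv (tangentIsometry p V) W p ^ 2) -
      (lap W p + ((n : ℝ) - 2) *
        ∑ k, dirDeriv (tangentIsometry p (EuclideanSpace.single k 1)) W p ^ 2 - ((n : ℝ) - 1)) *
          ‖V‖ ^ 2 := by
  have hW := (W.contDiffAt (ne_zero_of_norm_eq_one (norm_coe_Sn p))).of_le two_le_infty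
  have h1 : dirDeriv (tangentIsometry p V) W p ^ 2 =
      ∑ i, ∑ j, dirDeriv (tangentIsometry p (EuclideanSpace.single i 1)) W p *
        dirDeriv (tangentIsometry p (EuclideanSpace.single j 1)) W p * V i * V j := by
    rw [dirDeriv_tangentIsometry_eq_sum, pow_two, Finset.sum_mul_sum]
    refine Finset.sum_congr rfl fun i _ => Finset.sum_congr rfl fun j _ => ?_
    ring
  rw [dirDeriv_dirDeriv_tangentIsometry_eq_sum p hW, h1, ← sum_kronecker_mul_mul]
  simp only [ricciCoeff_conformalMetric h, ← Finset.sum_sub_distrib, Finset.mul_sum]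
  refine Finset.sum_congr rfl fun i _ => Finset.sum_congr rfl fun j _ => ?_
  ring

/-- By homogeneity the direction may be taken of unit length. `hessian_inequality` is then applied
with `ξ` the part of the gradient orthogonal to it, which absorbs `|∇w|² - dw(v)²`. -/
lemma sum_ricciCoeff_nonneg {m : ℕ} (hm : 1 ≤ m) {w : Sn (2 * m + 2) → ℝ}
    {W : SphereFun (EuclideanSpace ℝ (Fin (2 * m + 2 + 1)))} (h : ∀ q, w q = W q)
    (hW : ∀ x, ‖x‖ = 1 →
      0 ≤ polyOp (gjmsPoly (2 * m + 2) 0 (m + 1)) W x + (2 * m + 1).factorial)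
    (p : Sn (2 * m + 2)) (V : EuclideanSpace ℝ (Fin (2 * m + 2))) :
    0 ≤ ∑ i, ∑ j, ricciCoeff (metricCoeff (conformalMetric w (roundMetric (2 * m + 2))) p) i j 0 *
      V i * V j := by
  rcases eq_or_ne V 0 with rfl | hV0
  · simp
  have hr : 0 < ‖V‖ := norm_pos_iff.2 hV0
  obtain ⟨V', hV', hVr⟩ : ∃ V', ‖V'‖ = 1 ∧ V = ‖V‖ • V' :=
    ⟨‖V‖⁻¹ • V, by rw [norm_smul, norm_inv, norm_norm, inv_mul_cancel₀ hr.ne'],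
      by rw [smul_smul, mul_inv_cancel₀ hr.ne', one_smul]⟩
  set r := ‖V‖
  have hU := (tangentIsometry p).inner_map_map
  set d : EuclideanSpace ℝ (Fin (2 * m + 2)) := WithLp.toLp 2 fun k =>
    dirDeriv (tangentIsometry p (EuclideanSpace.single k 1)) W p with hd
  have hdin : ∀ V, dirDeriv (tangentIsometry p V) W p = ⟪d, V⟫ := fun V => by
    rw [dirDeriv_tangentIsometry_eq_sum]
    simp [PiLp.inner_apply, hd]
  have hds : ∑ k, dirDeriv (tangentIsometry p (EuclideanSpace.single k 1)) W p ^ 2 = ‖d‖ ^ 2 := by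
    rw [EuclideanSpace.real_norm_sq_eq]
  set g := d - ⟪d, V'⟫ • V' with hg
  have hVg : ⟪V', g⟫ = 0 := by
    rw [hg, inner_sub_right, inner_smul_right, real_inner_self_eq_norm_sq, hV', real_inner_comm]
    ring
  have hgn : ⟪d, g⟫ = ‖d‖ ^ 2 - ⟪d, V'⟫ ^ 2 := by
    rw [hg, inner_sub_right, inner_smul_right, real_inner_self_eq_norm_sq]
    ring
  -- As `g` is an orthogonal projection of the gradient `d`, this is the condition `dw(ξ) = |ξ|²`.
  have hgg : ‖g‖ ^ 2 = ⟪d, g⟫ := by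
    rw [← real_inner_self_eq_norm_sq]
    conv_lhs => rw [hg, inner_sub_left, ← hg, inner_smul_left, hVg, mul_zero, sub_zero]
  have key := hessian_inequality hm (by simp) W hW (norm_coe_Sn p)
    (v := tangentIsometry p V') (ξ := tangentIsometry p g)
    (by rw [(tangentIsometry p).norm_map, hV']) (inner_tangentIsometry p _)
    (inner_tangentIsometry p _) (by rw [hU, hVg])
    (by rw [hdin, (tangentIsometry p).norm_map, hgg])
  rw [(tangentIsometry p).norm_map, hgg, hgn] at key
  have hs : ∑ i, ∑ j, ricciCoeff (metricCoeff (conformalMetric w (roundMetric (2 * m + 2))) p) i j 0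
      * V i * V j = r ^ 2 * ∑ i, ∑ j, ricciCoeff
        (metricCoeff (conformalMetric w (roundMetric (2 * m + 2))) p) i j 0 * V' i * V' j := by
    simp only [Finset.mul_sum]
    refine Finset.sum_congr rfl fun i _ => Finset.sum_congr rfl fun j _ => ?_
    rw [hVr]
    simp only [PiLp.smul_apply, smul_eq_mul]
    ring
  rw [hs, sum_ricciCoeff_conformalMetric h, hdin, hds, hV']
  refine mul_nonneg (by positivity) (key.trans_eq ?_)
  push_cast
  ring

end Extension

end ConformalSphere

end

theorem theorem4p3 (n : ℕ) (hn : 4 ≤ n) (hn_even : Even n)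
    (w : ConformalSphere.Sn n → ℝ) (hw : ContMDiff (𝓡 n) 𝓘(ℝ, ℝ) ∞ w)
    (hQ : ∀ p : ConformalSphere.Sn n, 0 ≤ ConformalSphere.qCurvature n w p) :
    ∀ (p : ConformalSphere.Sn n) (v : TangentSpace (𝓡 n) p),
      0 ≤ ConformalSphere.ricci
        (ConformalSphere.conformalMetric w (ConformalSphere.roundMetric n)) p v v := by
  intro p v
  obtain ⟨m, rfl⟩ : ∃ m, n = 2 * m + 2 := by
    obtain ⟨k, hk⟩ := hn_even
    exact ⟨k - 1, by omega⟩
  obtain ⟨W, hW⟩ := ConformalSphere.exists_sphereFun hw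
  rw [ConformalSphere.ricci, ConformalSphere.extChartAt_self]
  -- The quadratic form is non-negative on all coordinate vectors, so `vecCoord` need not be
  -- computed.
  refine ConformalSphere.sum_ricciCoeff_nonneg (by omega) hW (fun x hx => ?_) p _
  have h := hQ ⟨x, by simpa using hx⟩
  rw [ConformalSphere.qCurvature, ConformalSphere.gjms,
    show (2 * m + 2) / 2 = m + 1 by omega, ConformalSphere.gjmsProd_eq_polyOp hW] at h
  exact nonneg_of_mul_nonneg_right h (Real.exp_pos _)
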